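/- All graphs are finite and simple. A graph is outerplanar if it has a planar embedding in which all the vertices lie on (the boundary of) a single face. A tree covering of a graph $G$ is a family of pairwise vertex-disjoint induced subgraphs of $G$, each of which is a tree, that together contain every vertex of $G$; it is minimum if no tree covering of $G$ has fewer trees. Two trees $T_1,T_2$ of a tree covering are adjacent if $G$ has an edge $uv$ with $u\in V(T_1)$ and $v\in V(T_2)$, and a tree of the covering is pendant if it is adjacent to exactly one other tree of the covering. Theorem 8.2 (pendant tree). Let $G$ be an outerplanar graph that contains a cycle. Then $G$ has a minimum tree covering that contains a pendant tree. -/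

import Mathlib

/-- The Euclidean plane. -/
abbrev EPlane : Type := EuclideanSpace ℝ (Fin 2)

/-- A planar embedding of a simple graph: distinct vertices are distinct points of the plane, an edge
`uv` is a simple arc from `u` to `v`, an edge passes through no vertex other than its two ends, and two
distinct edges meet at most in common ends. -/
structure PlanarEmbedding {V : Type*} (G : SimpleGraph V) where
  /-- the point representing a vertex -/
  point : V → EPlane
  /-- the arc (a subset of the plane) representing an edge -/
  arc : G.edgeSet → Set EPlane
  point_injective : Function.Injective point
  isArc : ∀ (e : G.edgeSet) (u v : V), (e : Sym2 V) = s(u, v) →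
    ∃ γ : Path (point u) (point v), Function.Injective γ ∧ Set.range γ = arc e
  mem_of_point_mem_arc : ∀ (e : G.edgeSet) (w : V), point w ∈ arc e → w ∈ (e : Sym2 V)
  arc_inter_arc : ∀ e f : G.edgeSet, e ≠ f → ∀ x ∈ arc e, x ∈ arc f →
    ∃ w : V, w ∈ (e : Sym2 V) ∧ w ∈ (f : Sym2 V) ∧ x = point w

namespace PlanarEmbedding

/-- The subset of the plane covered by the vertices and edges. -/
def drawing {V : Type*} {G : SimpleGraph V} (φ : PlanarEmbedding G) : Set EPlane :=
  Set.range φ.point ∪ ⋃ e : G.edgeSet, φ.arc e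

/-- The faces are the connected components of the complement of the drawing. -/
def IsFace {V : Type*} {G : SimpleGraph V} (φ : PlanarEmbedding G) (F : Set EPlane) : Prop :=
  ∃ x ∈ φ.drawingᶜ, F = connectedComponentIn φ.drawingᶜ x

end PlanarEmbedding

namespace SimpleGraph

/-- A graph is outerplanar if it has a planar embedding in which all the vertices lie on (the boundary
of) a single face. -/
def IsOuterplanar {V : Type*} (G : SimpleGraph V) : Prop :=
  ∃ φ : PlanarEmbedding G, ∃ F : Set EPlane, φ.IsFace F ∧ ∀ v : V, φ.point v ∈ frontier F

/-- A tree covering: a family of vertex-disjoint induced trees covering all the vertices. An induced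
tree is given by its vertex set. -/
structure IsTreeCovering {V : Type*} (G : SimpleGraph V) (𝒯 : Set (Set V)) : Prop where
  isTree : ∀ T ∈ 𝒯, (G.induce T).IsTree
  disjoint : ∀ S ∈ 𝒯, ∀ T ∈ 𝒯, S ≠ T → Disjoint S T
  cover : ∀ v : V, ∃ T ∈ 𝒯, v ∈ T

/-- A minimum tree covering: a tree covering with the least possible number of trees. -/
def IsMinimumTreeCovering {V : Type*} (G : SimpleGraph V) (𝒯 : Set (Set V)) : Prop :=
  G.IsTreeCovering 𝒯 ∧ ∀ 𝒮 : Set (Set V), G.IsTreeCovering 𝒮 → 𝒯.encard ≤ 𝒮.encard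

/-- Two trees (given by their vertex sets) are adjacent if some edge of the graph joins a vertex of the
one to a vertex of the other. -/
def AdjacentTrees {V : Type*} (G : SimpleGraph V) (S T : Set V) : Prop :=
  ∃ u ∈ S, ∃ v ∈ T, G.Adj u v

/-- A tree of the covering `𝒯` is pendant if it is adjacent to exactly one other tree of `𝒯`. -/
def IsPendantTree {V : Type*} (G : SimpleGraph V) (𝒯 : Set (Set V)) (T : Set V) : Prop :=
  T ∈ 𝒯 ∧ ∃! S : Set V, S ∈ 𝒯 ∧ S ≠ T ∧ G.AdjacentTrees T S

end SimpleGraph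

/-!
An outerplanar graph has no minor `K₄` or `K_{2,3}`: a new vertex in the common face, joined to all
others, would give a planar drawing of `K₅` or `K_{3,3}`, and these are excluded by adding up
increments of `log (γ s - δ t)` over pairs of disjoint edges `γ`, `δ`.

A tree covering amounts to an induced spanning forest, and a minimum one to such a forest with the
most edges. The theorem is proved by induction for graphs in which every edge may carry *ears*,
virtual vertices of degree two joined to both its ends. If there is no `K₄` minor, then some
vertex `v` other than a prescribed root has at most two neighbours `u` and `t`.

* If the edge `vt` has no ear, contract it: `v` becomes an ear at the edge `ut` if that is already
  there, and otherwise the ears at `vu` move to `ut`. Optimal forests, ears and pendant trees pull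
  back along the contraction.
* If both edges at `v` have ears, start from an optimal forest of `G - v`. Either the single tree
  `v` is pendant in it, or the edge `vu` can be added and its only ear is a pendant single tree, or
  `vu` has at least two ears. In the last case the absence of `K_{2,3}` forces `v` to separate `u`
  from `t`, and the induction applies to a branch at `v` avoiding the root, with `v` as new root.
-/

section LogIncrement

open Complex

theorem exists_continuous_exp_eq {X : Type*} [TopologicalSpace X] [LocallyPathConnectedSpace X]
    [SimplyConnectedSpace X] {f : X → ℂ} (hf : Continuous f) (h0 : ∀ x, f x ≠ 0) :
    ∃ L : X → ℂ, Continuous L ∧ ∀ x, exp (L x) = f x := by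
  obtain ⟨x₀⟩ : Nonempty X := inferInstance
  obtain ⟨L, ⟨-, hL⟩, -⟩ := isCoveringMapOn_exp.existsUnique_continuousMap_lifts
    (⟨f, hf⟩ : C(X, ℂ)) (exp_log (h0 x₀)) h0
  exact ⟨L, L.continuous, fun x => congrFun hL x⟩

theorem sub_eq_sub_of_exp_eq_exp {X : Type*} [TopologicalSpace X] [LocallyPathConnectedSpace X]
    [SimplyConnectedSpace X] {L M : X → ℂ} (hL : Continuous L) (hM : Continuous M)
    (h : ∀ x, exp (L x) = exp (M x)) (x y : X) : L y - L x = M y - M x := by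
  have hMx : exp (M x) = exp (L x) := (h x).symm
  obtain ⟨N, -, hN⟩ := isCoveringMapOn_exp.existsUnique_continuousMap_lifts
    (⟨fun y => exp (L y), by fun_prop⟩ : C(X, ℂ)) (a₀ := x) (e₀ := L x) rfl fun y => exp_ne_zero _
  have hL' := hN ⟨L, hL⟩ ⟨rfl, rfl⟩
  have hM' := hN ⟨fun y => M y + (L x - M x), by fun_prop⟩ ⟨by simp, by
    ext y
    simp [exp_add, exp_sub, hMx, h y]⟩
  have hy : L y = M y + (L x - M x) := DFunLike.congr_fun (hL'.trans hM'.symm) y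
  rw [hy]
  ring

variable {p u v w z : ℂ} {γ : Path u v} {δ : Path w z}

/-- The increment along the path `δ` of a continuous branch of `log (· - p)`; it is `0` by
convention if `δ` passes through `p`. -/
noncomputable def logIncrement (p : ℂ) (δ : Path w z) : ℂ :=
  open Classical in
  if h : ∃ L : ℝ → ℂ, Continuous L ∧ ∀ t, exp (L t) = δ.extend t - p then
    h.choose 1 - h.choose 0
  else 0

theorem logIncrement_eq {L : ℝ → ℂ} (hL : Continuous L)
    (h : ∀ t, exp (L t) = δ.extend t - p) : logIncrement p δ = L 1 - L 0 := by
  have hex : ∃ L : ℝ → ℂ, Continuous L ∧ ∀ t, exp (L t) = δ.extend t - p := ⟨L, hL, h⟩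
  rw [logIncrement, dif_pos hex]
  exact sub_eq_sub_of_exp_eq_exp hex.choose_spec.1 hL
    (fun t => (hex.choose_spec.2 t).trans (h t).symm) 0 1

theorem exp_logIncrement (hp : p ∉ Set.range δ) :
    exp (logIncrement p δ) = (z - p) / (w - p) := by
  obtain ⟨L, hL, hexp⟩ := exists_continuous_exp_eq (f := fun t => δ.extend t - p) (by fun_prop)
    fun t => sub_ne_zero.2 fun h => hp (δ.extend_range ▸ ⟨t, h⟩)
  simp [logIncrement_eq hL hexp, exp_sub, hexp]

/-- Integrate a branch of `log (δ t - γ s)` over the boundary of the square of all `(s, t)`. -/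
theorem logIncrement_sub_add_sub_eq_zero (h : Disjoint (Set.range γ) (Set.range δ)) :
    logIncrement u δ - logIncrement v δ + (logIncrement z γ - logIncrement w γ) = 0 := by
  obtain ⟨L, hL, hexp⟩ := exists_continuous_exp_eq
    (f := fun x : ℝ × ℝ => δ.extend x.2 - γ.extend x.1) (by fun_prop) fun x =>
      sub_ne_zero.2 (h.ne_of_mem (γ.extend_range ▸ ⟨x.1, rfl⟩) (δ.extend_range ▸ ⟨x.2, rfl⟩)).symm
  have hδ : ∀ s, logIncrement (γ.extend s) δ = L (s, 1) - L (s, 0) := fun s =>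
    logIncrement_eq (L := fun t => L (s, t)) (by fun_prop) fun t => hexp (s, t)
  have hγ : ∀ t, logIncrement (δ.extend t) γ = L (1, t) - L (0, t) := fun t => by
    rw [logIncrement_eq (L := fun s => L (s, t) + Real.pi * I) (by fun_prop) fun s => by
      rw [exp_add, exp_pi_mul_I, hexp]; ring]
    ring
  have hδ₀ := hδ 0
  have hδ₁ := hδ 1
  have hγ₀ := hγ 0
  have hγ₁ := hγ 1
  simp only [Path.extend_zero, Path.extend_one] at hδ₀ hδ₁ hγ₀ hγ₁
  rw [hδ₀, hδ₁, hγ₀, hγ₁]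
  ring

theorem sum_logIncrement_sub_eq_zero {P Q : Fin 3 → ℂ} (γ : ∀ i j, Path (P i) (Q j))
    (h : ∀ i j k l, i ≠ k → j ≠ l → Disjoint (Set.range (γ i j)) (Set.range (γ k l))) :
    ∑ l, (∑ i, logIncrement (P i) (γ (i + 1) l) - ∑ i, logIncrement (P i) (γ (i + 2) l)) = 0 := by
  let A l := ∑ i, logIncrement (P i) (γ (i + 1) l)
  let B l := ∑ i, logIncrement (P i) (γ (i + 2) l)
  let C j l := ∑ i, logIncrement (Q j) (γ i l)
  have hrel : ∀ j l, j ≠ l → A l - C j l + (C l j - B j) = 0 := fun j l hjl => by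
    have hC : C j l = ∑ i, logIncrement (Q j) (γ (i + 1) l) :=
      (Equiv.sum_comp (Equiv.addRight (1 : Fin 3)) fun i => logIncrement (Q j) (γ i l)).symm
    have hB : B j = ∑ i, logIncrement (P (i + 1)) (γ i j) := by
      rw [← Equiv.sum_comp (Equiv.addRight (2 : Fin 3))]
      simp [B, add_assoc, show (2 : Fin 3) + 1 = 0 from rfl]
    simp only [A, hC, C, hB, ← Finset.sum_sub_distrib, ← Finset.sum_add_distrib]
    exact Finset.sum_eq_zero fun i _ => logIncrement_sub_add_sub_eq_zero
      (h i j (i + 1) l (by simp) hjl)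
  rw [Fin.sum_univ_three]
  linear_combination (hrel 0 1 (by decide) + hrel 1 0 (by decide) + hrel 0 2 (by decide) +
    hrel 2 0 (by decide) + hrel 1 2 (by decide) + hrel 2 1 (by decide)) / 2

theorem not_planar_K33 {P Q : Fin 3 → ℂ} (γ : ∀ i j, Path (P i) (Q j))
    (h : ∀ i j k l, i ≠ k → j ≠ l → Disjoint (Set.range (γ i j)) (Set.range (γ k l))) : False := by
  have hP : ∀ i k l, i ≠ k → P i ∉ Set.range (γ k l) := fun i k l hik hi => by
    obtain ⟨j, hj⟩ := exists_ne l
    exact Set.disjoint_left.1 (h i j k l hik hj) ⟨0, (γ i j).source⟩ hi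
  have hne : ∀ i k, i ≠ k → P k - P i ≠ 0 := fun i k hik hki =>
    hP i k 0 hik ⟨0, by rw [(γ k 0).source]; exact sub_eq_zero.1 hki⟩
  have hQ : ∀ i l, Q l - P i ≠ 0 := fun i l hil => by
    obtain ⟨k, hk⟩ := exists_ne i
    exact hP i k l hk.symm ⟨1, by rw [(γ k l).target]; exact sub_eq_zero.1 hil⟩
  have hexp : ∀ l, exp (∑ i, logIncrement (P i) (γ (i + 1) l) -
      ∑ i, logIncrement (P i) (γ (i + 2) l)) = -1 := fun l => by
    have h01 := hne 0 1 (by decide)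
    have h12 := hne 1 2 (by decide)
    have h20 := hne 2 0 (by decide)
    have := hQ 0 l
    have := hQ 1 l
    have := hQ 2 l
    rw [exp_sub, exp_sum, exp_sum, Finset.prod_congr rfl fun i _ =>
        exp_logIncrement (hP i (i + 1) l (by simp)), Finset.prod_congr rfl fun i _ =>
        exp_logIncrement (hP i (i + 2) l (by simp))]
    simp only [Fin.prod_univ_three, show (0 : Fin 3) + 1 = 1 from rfl,
      show (1 : Fin 3) + 1 = 2 from rfl, show (2 : Fin 3) + 1 = 0 from rfl,
      show (0 : Fin 3) + 2 = 2 from rfl, show (1 : Fin 3) + 2 = 0 from rfl,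
      show (2 : Fin 3) + 2 = 1 from rfl,
      ← neg_sub (P 0) (P 2), ← neg_sub (P 1) (P 0), ← neg_sub (P 2) (P 1)]
    field_simp
  have hone := congrArg exp (sum_logIncrement_sub_eq_zero γ h)
  simp only [exp_sum, hexp] at hone
  norm_num at hone

/-- The total increment, over all vertices `a` of a drawing whose vertices are indexed by a finite
group, of `log (· - P a)` along the edge from `a + s` to `a + t`. Summing over the translates of a
pair of edges keeps the `K₅` argument within a single cyclic family of increments. -/
noncomputable def cyclicIncrement {ι : Type*} [AddCommGroup ι] [Fintype ι] {P : ι → ℂ}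
    (γ : ∀ i j, Path (P i) (P j)) (s t : ι) : ℂ :=
  ∑ a, logIncrement (P a) (γ (a + s) (a + t))

theorem cyclicIncrement_sub_add_sub_eq_zero {ι : Type*} [AddCommGroup ι] [Fintype ι] {P : ι → ℂ}
    (γ : ∀ i j, Path (P i) (P j)) {i j k l : ι}
    (h : ∀ a, Disjoint (Set.range (γ (a + i) (a + j))) (Set.range (γ (a + k) (a + l)))) :
    cyclicIncrement γ (k - i) (l - i) - cyclicIncrement γ (k - j) (l - j) +
      (cyclicIncrement γ (i - l) (j - l) - cyclicIncrement γ (i - k) (j - k)) = 0 := by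
  let Δ i k l := logIncrement (P i) (γ k l)
  have hshift : ∀ i k l, cyclicIncrement γ (k - i) (l - i) = ∑ a, Δ (a + i) (a + k) (a + l) :=
      fun i k l => by
    have := Equiv.sum_comp (Equiv.addRight i) fun a => Δ a (a + (k - i)) (a + (l - i))
    simp only [Equiv.coe_addRight, add_add_sub_cancel] at this
    exact this.symm
  simp only [hshift, ← Finset.sum_sub_distrib, ← Finset.sum_add_distrib]
  exact Finset.sum_eq_zero fun a _ => logIncrement_sub_add_sub_eq_zero (h a)

theorem cyclicIncrement_sub_sub_add_eq_zero {P : Fin 5 → ℂ} (γ : ∀ i j, Path (P i) (P j))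
    (h : ∀ i j k l, i ≠ j → k ≠ l → i ≠ k → i ≠ l → j ≠ k → j ≠ l →
      Disjoint (Set.range (γ i j)) (Set.range (γ k l))) :
    cyclicIncrement γ 2 3 - cyclicIncrement γ 3 4 - cyclicIncrement γ 4 1 +
      cyclicIncrement γ 2 4 = 0 := by
  let X := cyclicIncrement γ
  have hrel : ∀ i j k l, i ≠ j → k ≠ l → i ≠ k → i ≠ l → j ≠ k → j ≠ l →
      X (k - i) (l - i) - X (k - j) (l - j) + (X (i - l) (j - l) - X (i - k) (j - k)) = 0 :=
    fun i j k l hij hkl hik hil hjk hjl => cyclicIncrement_sub_add_sub_eq_zero γ fun a =>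
      h _ _ _ _ (by simpa) (by simpa) (by simpa) (by simpa) (by simpa) (by simpa)
  have h₁ : X 2 3 - X 1 2 + (X 2 3 - X 3 4) = 0 := by apply hrel 0 1 2 3 <;> decide
  have h₂ : X 1 3 - X 4 1 + (X 2 4 - X 4 1) = 0 := by apply hrel 0 2 1 3 <;> decide
  have h₃ : X 2 4 - X 1 3 + (X 1 2 - X 3 4) = 0 := by apply hrel 0 1 2 4 <;> decide
  linear_combination (h₁ + h₂ + h₃) / 2

theorem not_planar_K5 {P : Fin 5 → ℂ} (γ : ∀ i j, Path (P i) (P j))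
    (h : ∀ i j k l, i ≠ j → k ≠ l → i ≠ k → i ≠ l → j ≠ k → j ≠ l →
      Disjoint (Set.range (γ i j)) (Set.range (γ k l))) : False := by
  have hP : ∀ i k l, k ≠ l → i ≠ k → i ≠ l → P i ∉ Set.range (γ k l) :=
      fun i k l hkl hik hil hi => by
    obtain ⟨j, hji, hjk, hjl⟩ : ∃ j, j ≠ i ∧ j ≠ k ∧ j ≠ l := by
      clear * -
      decide +revert
    exact Set.disjoint_left.1 (h i j k l hji.symm hkl hik hil hjk hjl) ⟨0, (γ i j).source⟩ hi
  have hne : ∀ i k, i ≠ k → P k - P i ≠ 0 := fun i k hik hki => by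
    obtain ⟨j, hji, hjk⟩ : ∃ j, j ≠ i ∧ j ≠ k := by
      clear * -
      decide +revert
    exact hP i k j hjk.symm hik hji.symm ⟨0, by rw [(γ k j).source]; exact sub_eq_zero.1 hki⟩
  let X := cyclicIncrement γ
  let D t := ∏ a, (P (a + t) - P a)
  have hexp : ∀ s t, s ≠ t → s ≠ 0 → t ≠ 0 → exp (X s t) = D t / D s := fun s t hst hs ht => by
    simp only [X, cyclicIncrement]
    rw [exp_sum, ← Finset.prod_div_distrib]
    exact Finset.prod_congr rfl fun a _ => exp_logIncrement
      (hP _ _ _ (by simpa) (by simpa using hs) (by simpa using ht))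
  have hD : ∀ t, D (-t) = -D t := fun t => by
    have hshift : D (-t) = ∏ a, (P a - P (a + t)) :=
      (Equiv.prod_comp (Equiv.addRight t) _).symm.trans <| by
        simp only [Equiv.coe_addRight, add_neg_cancel_right]
    simp only [hshift, D, ← neg_sub (P (_ + t)), Finset.prod_neg]
    norm_num
  have hD0 : ∀ t, t ≠ 0 → D t ≠ 0 := fun t ht =>
    Finset.prod_ne_zero_iff.2 fun a _ => hne _ _ (by simpa using ht)
  have hone : exp (X 2 3 - X 3 4 - X 4 1 + X 2 4) = -1 := by
    have hD₁ := hD0 1 (by decide)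
    have hD₂ := hD0 2 (by decide)
    have hD₃ : D 3 = -D 2 := hD 2
    have hD₄ : D 4 = -D 1 := hD 1
    rw [exp_add, exp_sub, exp_sub, hexp 2 3, hexp 3 4, hexp 4 1, hexp 2 4, hD₃, hD₄]
    on_goal 1 => field_simp
    all_goals decide
  rw [cyclicIncrement_sub_sub_add_eq_zero γ h] at hone
  norm_num at hone

end LogIncrement

section EPlane

theorem disjoint_range_map {X Y : Type*} [TopologicalSpace X] [TopologicalSpace Y] {f : X → Y}
    (hf : Continuous f) (hinj : Function.Injective f) {u v w z : X} {γ : Path u v} {δ : Path w z}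
    (h : Disjoint (Set.range γ) (Set.range δ)) :
    Disjoint (Set.range (γ.map hf)) (Set.range (δ.map hf)) := by
  simpa only [Path.map_coe, Set.range_comp] using (Set.disjoint_image_iff hinj).2 h

theorem not_joinedIn_K5 {P : Fin 5 → EPlane} {R : Fin 5 → Fin 5 → Set EPlane}
    (hj : ∀ i j, i ≠ j → JoinedIn (R i j) (P i) (P j))
    (hd : ∀ i j k l, i ≠ j → k ≠ l → i ≠ k → i ≠ l → j ≠ k → j ≠ l →
      Disjoint (R i j) (R k l)) : False := by
  have hpath : ∀ i j, ∃ γ : Path (P i) (P j), i ≠ j → Set.range γ ⊆ R i j := fun i j => by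
    obtain rfl | hij := eq_or_ne i j
    · exact ⟨Path.refl _, fun h => (h rfl).elim⟩
    · exact ⟨(hj i j hij).somePath, fun _ => Set.range_subset_iff.2 (hj i j hij).somePath_mem⟩
  choose γ hγ using hpath
  let f : EPlane ≃ₗᵢ[ℝ] ℂ := Complex.orthonormalBasisOneI.repr.symm
  exact not_planar_K5 (fun i j => (γ i j).map f.continuous) fun i j k l hij hkl hik hil hjk hjl =>
    disjoint_range_map _ f.injective
      ((hd i j k l hij hkl hik hil hjk hjl).mono (hγ i j hij) (hγ k l hkl))

theorem not_joinedIn_K33 {P Q : Fin 3 → EPlane} {R : Fin 3 → Fin 3 → Set EPlane}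
    (hj : ∀ i j, JoinedIn (R i j) (P i) (Q j))
    (hd : ∀ i j k l, i ≠ k → j ≠ l → Disjoint (R i j) (R k l)) : False := by
  have hR : ∀ i j, Set.range (hj i j).somePath ⊆ R i j := fun i j =>
    Set.range_subset_iff.2 (hj i j).somePath_mem
  let f : EPlane ≃ₗᵢ[ℝ] ℂ := Complex.orthonormalBasisOneI.repr.symm
  exact not_planar_K33 (fun i j => (hj i j).somePath.map f.continuous) fun i j k l hik hjl =>
    disjoint_range_map _ f.injective ((hd i j k l hik hjl).mono (hR i j) (hR k l))

end EPlane

namespace PlanarEmbedding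

open SimpleGraph

variable {V : Type*} {G : SimpleGraph V} (φ : PlanarEmbedding G) {S T : Set V} {x y : V}

/-- The part of the drawing spanned by the vertices in `S`. -/
def region (S : Set V) : Set EPlane :=
  φ.point '' S ∪ ⋃ e ∈ {e : G.edgeSet | ∀ v ∈ (e : Sym2 V), v ∈ S}, φ.arc e

theorem region_mono (h : S ⊆ T) : φ.region S ⊆ φ.region T :=
  Set.union_subset_union (Set.image_mono h)
    (Set.biUnion_subset_biUnion_left fun _ he v hv => h (he v hv))

theorem region_subset_drawing : φ.region S ⊆ φ.drawing :=
  Set.union_subset_union (Set.image_subset_range _ _) (Set.iUnion₂_subset_iUnion _ _)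

theorem isClosed_arc (e : G.edgeSet) : IsClosed (φ.arc e) := by
  obtain ⟨γ, -, hγ⟩ := φ.isArc e _ _ (Quot.out_eq (e : Sym2 V)).symm
  rw [← hγ]
  exact (isCompact_range γ.continuous).isClosed

theorem isClosed_drawing [Finite V] : IsClosed φ.drawing :=
  (Set.finite_range _).isClosed.union (isClosed_iUnion_of_finite φ.isClosed_arc)

theorem isClosed_region [Finite V] : IsClosed (φ.region S) :=
  ((Set.toFinite S).image _).isClosed.union
    ((Set.toFinite _).isClosed_biUnion fun e _ => φ.isClosed_arc e)

theorem point_mem_region_iff : φ.point x ∈ φ.region S ↔ x ∈ S := by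
  refine ⟨?_, fun h => Or.inl ⟨x, h, rfl⟩⟩
  rintro (⟨v, hv, hvx⟩ | hp)
  · exact φ.point_injective hvx ▸ hv
  · obtain ⟨e, he, hx⟩ := Set.mem_iUnion₂.1 hp
    exact he x (φ.mem_of_point_mem_arc e x hx)

theorem disjoint_region (h : Disjoint S T) : Disjoint (φ.region S) (φ.region T) := by
  rw [Set.disjoint_left] at h ⊢
  rintro p (⟨v, hv, rfl⟩ | hp) hT
  · exact h hv (φ.point_mem_region_iff.1 hT)
  obtain ⟨v, hv, rfl⟩ | hp' := hT
  · exact h (φ.point_mem_region_iff.1 (Or.inr hp)) hv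
  obtain ⟨e, he, hpe⟩ := Set.mem_iUnion₂.1 hp
  obtain ⟨f, hf, hpf⟩ := Set.mem_iUnion₂.1 hp'
  obtain rfl | hef := eq_or_ne e f
  · exact h (he _ (Sym2.out_fst_mem _)) (hf _ (Sym2.out_fst_mem _))
  · obtain ⟨w, hwe, hwf, -⟩ := φ.arc_inter_arc e f hef p hpe hpf
    exact h (he w hwe) (hf w hwf)

theorem joinedIn_region (hS : (G.induce S).Preconnected) (hx : x ∈ S) (hy : y ∈ S) :
    JoinedIn (φ.region S) (φ.point x) (φ.point y) := by
  suffices h : ∀ a b : S, (G.induce S).Walk a b → JoinedIn (φ.region S) (φ.point a) (φ.point b) from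
    (hS ⟨x, hx⟩ ⟨y, hy⟩).elim (h _ _)
  intro a b p
  induction p with
  | nil => exact JoinedIn.refl (φ.point_mem_region_iff.2 (Subtype.prop _))
  | @cons a b c hab _ ih =>
    obtain ⟨γ, -, hγ⟩ := φ.isArc ⟨s(a, b), hab⟩ a b rfl
    have hab : JoinedIn (φ.region S) (φ.point a) (φ.point b) := ⟨γ, fun t => Or.inr <|
      Set.mem_iUnion₂.2 ⟨⟨s(a, b), hab⟩, by simp, hγ ▸ ⟨t, rfl⟩⟩⟩
    exact hab.trans ih

theorem exists_apex [Finite V] {F : Set EPlane} (hF : φ.IsFace F)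
    (hfr : ∀ v, φ.point v ∈ frontier F) :
    ∃ (p : EPlane) (A : V → Set EPlane), (∀ v, JoinedIn (A v) p (φ.point v)) ∧
      ∀ v S, v ∉ S → Disjoint (A v) (φ.region S) := by
  obtain ⟨p, hp, rfl⟩ := hF
  set F := connectedComponentIn φ.drawingᶜ p
  have hpath : IsPathConnected F :=
    (φ.isClosed_drawing.isOpen_compl.connectedComponentIn.isConnected_iff_isPathConnected).1
      (isConnected_connectedComponentIn_iff.2 hp)
  have hball : ∀ v, ∃ ε > 0, Metric.ball (φ.point v) ε ⊆ (φ.region {v}ᶜ)ᶜ := fun v =>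
    Metric.isOpen_iff.1 φ.isClosed_region.isOpen_compl _ (by simp [point_mem_region_iff])
  choose ε hε hball using hball
  refine ⟨p, fun v => F ∪ Metric.ball (φ.point v) (ε v), fun v => ?_, fun v S hv => ?_⟩
  · obtain ⟨q, hqF, hqv⟩ := Metric.mem_closure_iff.1 (frontier_subset_closure (hfr v)) _ (hε v)
    have hpq := hpath.joinedIn p (mem_connectedComponentIn hp) q hqF
    have hqv := ((convex_ball (φ.point v) (ε v)).isPathConnected
      ⟨_, Metric.mem_ball_self (hε v)⟩).joinedIn q (Metric.mem_ball'.2 hqv) _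
      (Metric.mem_ball_self (hε v))
    exact (hpq.mono Set.subset_union_left).trans (hqv.mono Set.subset_union_right)
  · have hF : F ⊆ φ.drawingᶜ := connectedComponentIn_subset _ _
    have hS : S ⊆ {v}ᶜ := Set.subset_compl_singleton_iff.2 hv
    exact Set.disjoint_union_left.2
      ⟨Set.disjoint_left.2 fun x hx hxS => hF hx (φ.region_subset_drawing hxS),
        Set.disjoint_left.2 fun x hx hxS => hball v hx (φ.region_mono hS hxS)⟩

end PlanarEmbedding

section Minor

open SimpleGraph

theorem adjacentTrees_comm {V : Type*} {G : SimpleGraph V} {S T : Set V} :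
    G.AdjacentTrees S T ↔ G.AdjacentTrees T S := by
  constructor <;> exact fun ⟨a, ha, b, hb, hab⟩ => ⟨b, hb, a, ha, hab.symm⟩

/-- `B` is a model of `H` as a minor of `G`: contracting each branch set `B i` to the vertex `i`
turns a subgraph of `G` into `H`. -/
structure IsMinorModel {W V : Type*} (H : SimpleGraph W) (G : SimpleGraph V) (B : W → Set V) :
    Prop where
  connected : ∀ i, (G.induce (B i)).Connected
  disjoint : ∀ i j, i ≠ j → Disjoint (B i) (B j)
  adjacent : ∀ i j, H.Adj i j → G.AdjacentTrees (B i) (B j)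

/-- `H` is a minor of `G`. -/
def IsMinor {W V : Type*} (H : SimpleGraph W) (G : SimpleGraph V) : Prop :=
  ∃ B : W → Set V, IsMinorModel H G B

namespace IsMinorModel

variable {W V : Type*} {H : SimpleGraph W} {G : SimpleGraph V} {B : W → Set V}

theorem of_lt [LinearOrder W] (hconn : ∀ i, (G.induce (B i)).Connected)
    (hdisj : ∀ i j, i < j → Disjoint (B i) (B j))
    (hadj : ∀ i j, i < j → H.Adj i j → G.AdjacentTrees (B i) (B j)) : IsMinorModel H G B := by
  refine ⟨hconn, fun i j hij => ?_, fun i j hij => ?_⟩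
  · exact hij.lt_or_gt.elim (hdisj i j) fun h => (hdisj j i h).symm
  · exact hij.ne.lt_or_gt.elim (fun h => hadj i j h hij) fun h =>
      adjacentTrees_comm.1 (hadj j i h hij.symm)

theorem mono {G' : SimpleGraph V} (h : IsMinorModel H G B) (hle : G ≤ G') :
    IsMinorModel H G' B := by
  refine ⟨fun i => (h.connected i).mono fun _ _ hab => hle hab, h.disjoint, fun i j hij => ?_⟩
  obtain ⟨a, ha, b, hb, hab⟩ := h.adjacent i j hij
  exact ⟨a, ha, b, hb, hle hab⟩

theorem comp {W' : Type*} {H' : SimpleGraph W'} {f : W' → W} (h : IsMinorModel H G B)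
    (hf : Function.Injective f) (hadj : ∀ i j, H'.Adj i j → H.Adj (f i) (f j)) :
    IsMinorModel H' G (B ∘ f) :=
  ⟨fun i => h.connected (f i), fun _ _ hij => h.disjoint _ _ (hf.ne hij),
    fun i j hij => h.adjacent _ _ (hadj i j hij)⟩

theorem nonempty (h : IsMinorModel H G B) (i : W) : (B i).Nonempty :=
  Set.nonempty_coe_sort.1 (h.connected i).nonempty

theorem joinedIn_region (h : IsMinorModel H G B) (φ : PlanarEmbedding G) {i j : W}
    (hij : H.Adj i j) {x y : V} (hx : x ∈ B i) (hy : y ∈ B j) :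
    JoinedIn (φ.region (B i ∪ B j)) (φ.point x) (φ.point y) := by
  obtain ⟨u, hu, v, hv, huv⟩ := h.adjacent i j hij
  exact φ.joinedIn_region (connected_induce_union (h.connected i).preconnected
    (h.connected j).preconnected hu hv huv).preconnected (Or.inl hx) (Or.inr hy)

theorem notMem_union (h : IsMinorModel H G B) {i j k : W} (hij : i ≠ j) (hik : i ≠ k) {x : V}
    (hx : x ∈ B i) : x ∉ B j ∪ B k :=
  Set.disjoint_left.1 (Set.disjoint_union_right.2 ⟨h.disjoint i j hij, h.disjoint i k hik⟩) hx

theorem disjoint_region (h : IsMinorModel H G B) (φ : PlanarEmbedding G) {i j k l : W}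
    (hik : i ≠ k) (hil : i ≠ l) (hjk : j ≠ k) (hjl : j ≠ l) :
    Disjoint (φ.region (B i ∪ B j)) (φ.region (B k ∪ B l)) :=
  φ.disjoint_region <| Set.disjoint_left.2 fun _ hx =>
    hx.elim (h.notMem_union hik hil) (h.notMem_union hjk hjl)

theorem not_isOuterplanar_of_K4 [Finite V] {B : Fin 4 → Set V}
    (h : IsMinorModel (⊤ : SimpleGraph (Fin 4)) G B) : ¬ G.IsOuterplanar := by
  rintro ⟨φ, F, hF, hfr⟩
  obtain ⟨p, A, hA, hA'⟩ := φ.exists_apex hF hfr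
  choose b hb using h.nonempty
  refine not_joinedIn_K5 (P := Fin.cons p fun i => φ.point (b i))
    (R := Fin.cons (Fin.cons Set.univ fun i => A (b i))
      fun i => Fin.cons (A (b i)) fun j => φ.region (B i ∪ B j)) ?_ ?_
  · intro i j
    refine Fin.cases ?_ (fun i => ?_) i <;> refine Fin.cases ?_ (fun j => ?_) j <;> intro hij
    · exact (hij rfl).elim
    · exact hA _
    · exact (hA _).symm
    · exact h.joinedIn_region φ (fun hij' => hij (congrArg Fin.succ hij')) (hb i) (hb j)
  · have hAd : ∀ i k l, i ≠ k → i ≠ l → Disjoint (A (b i)) (φ.region (B k ∪ B l)) :=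
      fun i k l hk hl => hA' _ _ (h.notMem_union hk hl (hb i))
    intro i j k l
    refine Fin.cases ?_ (fun i => ?_) i <;> refine Fin.cases ?_ (fun j => ?_) j <;>
      refine Fin.cases ?_ (fun k => ?_) k <;> refine Fin.cases ?_ (fun l => ?_) l <;>
      intro hij hkl hik hil hjk hjl <;> first | exact absurd rfl ‹_› | skip
    all_goals simp only [ne_eq, Fin.succ_inj] at *
    · exact hAd _ _ _ hjk hjl
    · exact hAd _ _ _ hik hil
    · exact (hAd _ _ _ (Ne.symm hil) (Ne.symm hjl)).symm
    · exact (hAd _ _ _ (Ne.symm hik) (Ne.symm hjk)).symm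
    · exact h.disjoint_region φ hik hil hjk hjl

theorem not_isOuterplanar_of_K23 [Finite V] {B : Fin 2 ⊕ Fin 3 → Set V}
    (h : IsMinorModel (completeBipartiteGraph (Fin 2) (Fin 3)) G B) : ¬ G.IsOuterplanar := by
  rintro ⟨φ, F, hF, hfr⟩
  obtain ⟨p, A, hA, hA'⟩ := φ.exists_apex hF hfr
  choose b hb using h.nonempty
  have hAd : ∀ (i : Fin 2) (j l : Fin 3), j ≠ l →
      Disjoint (A (b (.inr j))) (φ.region (B (.inl i) ∪ B (.inr l))) := fun i j l hjl =>
    hA' _ _ (h.notMem_union Sum.inr_ne_inl (Sum.inr_injective.ne hjl) (hb _))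
  refine not_joinedIn_K33 (P := Fin.cons p fun i => φ.point (b (.inl i)))
    (Q := fun j => φ.point (b (.inr j)))
    (R := Fin.cons (fun j => A (b (.inr j))) fun i j => φ.region (B (.inl i) ∪ B (.inr j))) ?_ ?_
  · intro i j
    refine Fin.cases ?_ (fun i => ?_) i
    · exact hA _
    · exact h.joinedIn_region φ (by simp) (hb _) (hb _)
  · intro i j k l
    refine Fin.cases ?_ (fun i => ?_) i <;> refine Fin.cases ?_ (fun k => ?_) k <;> intro hik hjl
    · exact absurd rfl hik
    · exact hAd _ _ _ hjl
    · exact (hAd _ _ _ hjl.symm).symm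
    · exact h.disjoint_region φ (by simpa using hik) (by simp) (by simp) (by simpa using hjl)

end IsMinorModel

theorem IsMinor.mono {W V : Type*} {H : SimpleGraph W} {G G' : SimpleGraph V} (h : IsMinor H G)
    (hle : G ≤ G') : IsMinor H G' := by
  obtain ⟨B, hB⟩ := h
  exact ⟨B, hB.mono hle⟩

end Minor

section Degree

open SimpleGraph

variable {V : Type*} {G : SimpleGraph V} {r : V}

/-- `l` lists the vertices of a path of `G`, starting anywhere and ending at `r`. -/
def IsPathTo (G : SimpleGraph V) (r : V) (l : List V) : Prop :=
  l.IsChain G.Adj ∧ l.Nodup ∧ l.getLast? = some r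

/-- The neighbours of `v` are `u` and `t`. This includes the case `u = t` of a leaf `v`. -/
structure HasNeighbors (G : SimpleGraph V) (v u t : V) : Prop where
  left : G.Adj v u
  right : G.Adj v t
  eq_or_eq : ∀ x, G.Adj v x → x = u ∨ x = t

theorem HasNeighbors.symm {v u t : V} (h : HasNeighbors G v u t) : HasNeighbors G v t u :=
  ⟨h.right, h.left, fun x hx => (h.eq_or_eq x hx).symm⟩

theorem connected_induce_of_isChain {l : List V} (hl : l.IsChain G.Adj) (hne : l ≠ []) :
    (G.induce {v | v ∈ l}).Connected := by
  have hconn := (Walk.ofSupport l hne hl).connected_induce_support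
  rwa [Walk.support_ofSupport] at hconn

namespace IsPathTo

theorem isMinor_K4 {x y w z z' : V} {A B : List V}
    (h : IsPathTo G r (x :: A ++ y :: w :: B)) (hxw : G.Adj x w) (hz : z ∈ B) (hxz : G.Adj x z)
    (hz' : z' ∈ B) (hyz' : G.Adj y z') : IsMinor (⊤ : SimpleGraph (Fin 4)) G := by
  obtain ⟨hchain, hnodup, -⟩ := h
  obtain ⟨b, B, rfl⟩ := List.exists_cons_of_ne_nil (List.ne_nil_of_mem hz)
  obtain ⟨hA, hywB, hxy⟩ := List.isChain_append.1 hchain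
  simp only [List.isChain_cons_cons] at hywB
  obtain ⟨hyw, hwb, hB⟩ := hywB
  refine ⟨![{v | v ∈ x :: A}, {y}, {w}, {v | v ∈ b :: B}], .of_lt ?_ ?_ ?_⟩
  · intro i
    fin_cases i
    · exact connected_induce_of_isChain hA (by simp)
    · exact .of_subsingleton (V := ({y} : Set V))
    · exact .of_subsingleton (V := ({w} : Set V))
    · exact connected_induce_of_isChain hB (by simp)
  · obtain ⟨-, hywB, hA_ne⟩ := List.nodup_append.1 hnodup
    simp only [List.nodup_cons, List.mem_cons, not_or] at hywB
    intro i j hij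
    fin_cases i <;> fin_cases j <;> first | exact absurd hij (by decide) | skip
    · exact Set.disjoint_singleton_right.2 fun hy => hA_ne y hy y (by simp) rfl
    · exact Set.disjoint_singleton_right.2 fun hw => hA_ne w hw w (by simp) rfl
    · exact Set.disjoint_left.2 fun v hv hv' => hA_ne v hv v (by simp [List.mem_cons.1 hv']) rfl
    · exact Set.disjoint_singleton.2 hywB.1.1
    · exact Set.disjoint_singleton_left.2 (by simpa using hywB.1.2)
    · exact Set.disjoint_singleton_left.2 (by simpa using hywB.2.1)
  · intro i j hij _
    fin_cases i <;> fin_cases j <;> first | exact absurd hij (by decide) | skip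
    · exact ⟨_, List.getLast_mem (List.cons_ne_nil x A), y, rfl,
        hxy _ (List.getLast_mem_getLast? _) y rfl⟩
    · exact ⟨x, by simp, w, rfl, hxw⟩
    · exact ⟨x, by simp, z, hz, hxz⟩
    · exact ⟨y, rfl, w, rfl, hyw⟩
    · exact ⟨y, rfl, z', hz', hyz'⟩
    · exact ⟨w, rfl, b, by simp, hwb⟩

theorem mem_of_adj_head {x z : V} {l : List V} (h : IsPathTo G r (x :: l))
    (hmax : ∀ l', IsPathTo G r l' → l'.length ≤ (x :: l).length) (hxz : G.Adj x z) : z ∈ l := by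
  by_contra hz
  have := hmax (z :: x :: l) ⟨List.isChain_cons_cons.2 ⟨hxz.symm, h.1⟩,
    List.nodup_cons.2 ⟨by simp [hz, hxz.ne'], h.2.1⟩, by simpa using h.2.2⟩
  simp at this

theorem ne_of_cons {x : V} {l : List V} (h : IsPathTo G r (x :: l)) (hl : l ≠ []) : x ≠ r := by
  rintro rfl
  have hlast := h.2.2
  rw [List.getLast?_cons_of_ne_nil hl] at hlast
  exact (List.nodup_cons.1 h.2.1).1 (List.mem_of_getLast? hlast)

theorem reverse_append {w x : V} {A B : List V} (h : IsPathTo G r (x :: A ++ w :: B))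
    (hxw : G.Adj x w) : IsPathTo G r ((x :: A).reverse ++ w :: B) := by
  obtain ⟨hchain, hnodup, hlast⟩ := h
  refine ⟨?_, ?_, ?_⟩
  · obtain ⟨hA, hB, -⟩ := List.isChain_append.1 hchain
    refine List.isChain_append.2 ⟨?_, hB, by simpa using hxw⟩
    simpa only [List.isChain_reverse, G.adj_comm] using hA
  · exact ((List.reverse_perm _).append_right _).nodup_iff.2 hnodup
  · rwa [List.getLast?_append_of_ne_nil _ (List.cons_ne_nil _ _)] at hlast ⊢

theorem exists_adj_or_hasNeighbors {x w : V} {A B : List V}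
    (h : IsPathTo G r (x :: A ++ w :: B)) (hA : A ≠ [])
    (hmax : ∀ l, IsPathTo G r l → l.length ≤ (x :: A ++ w :: B).length) (hxw : G.Adj x w)
    (ih : ∀ A' w' B', IsPathTo G r (x :: A' ++ w' :: B') → A' ≠ [] → G.Adj x w' →
      (x :: A' ++ w' :: B').length = (x :: A ++ w :: B).length → A'.length < A.length →
      ∃ v ≠ r, ∃ u t, HasNeighbors G v u t) :
    (∃ v ≠ r, ∃ u t, HasNeighbors G v u t) ∨ ∃ z ∈ B, G.Adj x z := by
  obtain ⟨y, A, rfl⟩ := List.exists_cons_of_ne_nil hA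
  have hxy : G.Adj x y := (List.isChain_cons_cons.1 h.1).1
  by_cases hdeg : ∀ z, G.Adj x z → z = y ∨ z = w
  · exact Or.inl ⟨x, h.ne_of_cons (by simp), y, w, hxy, hxw, hdeg⟩
  · push Not at hdeg
    obtain ⟨z, hxz, hzy, hzw⟩ := hdeg
    have hz := h.mem_of_adj_head (l := y :: A ++ w :: B) hmax hxz
    simp only [List.cons_append, List.mem_cons, hzy, List.mem_append, hzw, false_or] at hz
    obtain hz | hz := hz
    · obtain ⟨A₁, A₂, rfl⟩ := List.append_of_mem hz
      left
      refine ih (y :: A₁) z (A₂ ++ w :: B) (by simpa using h) (by simp) hxz (by simp) (by simp)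
    · exact Or.inr ⟨z, hz, hxz⟩

theorem exists_hasNeighbors (hK : ¬ IsMinor (⊤ : SimpleGraph (Fin 4)) G) {n : ℕ}
    (hmax : ∀ l, IsPathTo G r l → l.length ≤ n) {x w : V} {A B : List V}
    (h : IsPathTo G r (x :: A ++ w :: B)) (hlen : (x :: A ++ w :: B).length = n) (hA : A ≠ [])
    (hxw : G.Adj x w) : ∃ v ≠ r, ∃ u t, HasNeighbors G v u t := by
  induction hm : A.length using Nat.strong_induction_on generalizing x w A B with
  | _ m ih =>
    subst hm hlen
    obtain hv | ⟨z, hz, hxz⟩ := h.exists_adj_or_hasNeighbors hA hmax hxw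
      fun A' w' B' h' hA' hxw' hlen hlt => ih _ hlt h' hlen hA' hxw' rfl
    · exact hv
    obtain rfl | ⟨A, y, rfl⟩ := List.eq_nil_or_concat' A
    · exact absurd rfl hA
    have hrev : IsPathTo G r (y :: (x :: A).reverse ++ w :: B) := by
      simpa using h.reverse_append hxw
    have hyw : G.Adj y w :=
      ((List.isChain_append_cons_cons (l₁ := x :: A)).1 (by simpa using h.1)).2.1
    obtain hv | ⟨z', hz', hyz'⟩ := hrev.exists_adj_or_hasNeighbors (by simp) (by simpa using hmax)
      hyw fun A' w' B' h' hA' hyw' hlen hlt =>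
        ih _ (by simpa using hlt) h' (by simpa using hlen) hA' hyw' rfl
    · exact hv
    · exact (hK (isMinor_K4 (A := A) (by simpa using h) hxw hz hxz hz' hyz')).elim

end IsPathTo

theorem exists_hasNeighbors_of_mem_support [Finite V]
    (hK : ¬ IsMinor (⊤ : SimpleGraph (Fin 4)) G) (hr : r ∈ G.support) :
    ∃ v ≠ r, ∃ u t, HasNeighbors G v u t := by
  obtain ⟨s, hrs⟩ := hr
  have := Fintype.ofFinite V
  have hbdd : BddAbove (List.length '' {l | IsPathTo G r l}) := by
    refine ⟨Fintype.card V, ?_⟩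
    rintro _ ⟨l, hl, rfl⟩
    exact hl.2.1.length_le_card
  have hsr : IsPathTo G r [s, r] := ⟨by simpa using hrs.symm, by simpa using hrs.ne', by simp⟩
  have hne : {l | IsPathTo G r l}.Nonempty := ⟨[s, r], hsr⟩
  obtain ⟨l, hl, hlmax⟩ := Nat.sSup_mem (hne.image List.length) hbdd
  have hmax : ∀ l', IsPathTo G r l' → l'.length ≤ l.length := fun l' hl' =>
    hlmax ▸ le_csSup hbdd (Set.mem_image_of_mem _ hl')
  match l, hmax [s, r] hsr with
  | x :: y :: l, _ =>
    have hxy : G.Adj x y := (List.isChain_cons_cons.1 hl.1).1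
    by_cases hdeg : ∀ z, G.Adj x z → z = y ∨ z = y
    · exact ⟨x, hl.ne_of_cons (by simp), y, y, hxy, hxy, hdeg⟩
    · push Not at hdeg
      obtain ⟨z, hxz, hzy, -⟩ := hdeg
      obtain ⟨A, B, rfl⟩ :=
        List.append_of_mem (List.mem_of_ne_of_mem hzy (hl.mem_of_adj_head hmax hxz))
      exact hl.exists_hasNeighbors (A := y :: A) hK hmax rfl (by simp) hxz

theorem exists_hasNeighbors [Finite V] (hK : ¬ IsMinor (⊤ : SimpleGraph (Fin 4)) G)
    (hG : G ≠ ⊥) (r : V) : ∃ v ≠ r, ∃ u t, HasNeighbors G v u t := by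
  by_cases hr : r ∈ G.support
  · exact exists_hasNeighbors_of_mem_support hK hr
  · obtain ⟨a, b, hab⟩ := ne_bot_iff_exists_adj.1 hG
    obtain ⟨v, -, u, t, hv⟩ := exists_hasNeighbors_of_mem_support hK ⟨b, hab⟩
    exact ⟨v, fun h => hr (h ▸ ⟨u, hv.left⟩), u, t, hv⟩

end Degree

section InducedForest

open SimpleGraph

variable {V : Type*} {G F : SimpleGraph V} {S : Set V} {u v x y : V}

/-- The subgraph of `G` formed by the edges with both ends in `S`, on the same vertex type. -/
def within (G : SimpleGraph V) (S : Set V) : SimpleGraph V where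
  Adj x y := G.Adj x y ∧ x ∈ S ∧ y ∈ S
  symm := ⟨fun _ _ h => ⟨h.1.symm, h.2.2, h.2.1⟩⟩
  loopless := ⟨fun _ h => h.1.ne rfl⟩

theorem within_adj : (within G S).Adj x y ↔ G.Adj x y ∧ x ∈ S ∧ y ∈ S := Iff.rfl

theorem within_le : within G S ≤ G := fun _ _ h => h.1

theorem within_mono (h : F ≤ G) : within F S ≤ within G S := fun _ _ hxy => ⟨h hxy.1, hxy.2⟩

theorem support_within_subset : (within G S).support ⊆ S := fun _ ⟨_, h⟩ => h.2.1

theorem mem_of_reachable_within (h : (within G S).Reachable x y) (hxy : x ≠ y) : x ∈ S :=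
  support_within_subset (mem_support_of_reachable hxy h)

/-- `F` is a spanning forest of `G` whose trees are induced subgraphs of `G`. Vertices that are
isolated in `F` count as trees, so such forests correspond to the tree coverings of `G`. -/
structure IsInducedForest (G F : SimpleGraph V) : Prop where
  isAcyclic : F.IsAcyclic
  le : F ≤ G
  adj : ∀ ⦃x y⦄, G.Adj x y → F.Reachable x y → F.Adj x y

namespace IsInducedForest

theorem bot (G : SimpleGraph V) : IsInducedForest G ⊥ :=
  ⟨isAcyclic_bot, bot_le, fun _ _ hxy h => (hxy.ne (reachable_bot.1 h)).elim⟩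

theorem within_within (h : IsInducedForest G F) (S : Set V) :
    IsInducedForest (within G S) (within F S) :=
  ⟨h.isAcyclic.anti within_le, within_mono h.le,
    fun _ _ hxy hr => ⟨h.adj hxy.1 (hr.mono within_le), hxy.2⟩⟩

theorem of_within (h : IsInducedForest (within G S) F) : IsInducedForest G F :=
  ⟨h.isAcyclic, h.le.trans within_le, fun _ _ hxy hr => h.adj
    ⟨hxy, mem_of_reachable_within (hr.mono h.le) hxy.ne,
      mem_of_reachable_within (hr.symm.mono h.le) hxy.ne'⟩ hr⟩

theorem not_reachable_deleteEdges (h : IsInducedForest G F) (hxy : F.Adj x y) :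
    ¬ (F.deleteEdges {s(x, y)}).Reachable x y :=
  isBridge_iff.1 (isAcyclic_iff_forall_adj_isBridge.1 h.isAcyclic hxy)

theorem not_adj_of_adj_adj (h : IsInducedForest G F) (hxu : F.Adj x u) (hxv : F.Adj x v)
    (huv : u ≠ v) : ¬ G.Adj u v := by
  intro hG
  have hux : (F.deleteEdges {s(u, v)}).Adj u x := by simp [hxu.symm, huv, hxv.ne]
  have hxv' : (F.deleteEdges {s(u, v)}).Adj x v := by simp [hxv, hxv.ne, hxu.ne]
  exact h.not_reachable_deleteEdges (h.adj hG (hxu.symm.reachable.trans hxv.reachable))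
    (hux.reachable.trans hxv'.reachable)

theorem deleteEdges (h : IsInducedForest G F) (e : Sym2 V) :
    IsInducedForest G (F.deleteEdges {e}) := by
  refine ⟨h.isAcyclic.anti (deleteEdges_le _), (deleteEdges_le _).trans h.le, fun x y hxy hr => ?_⟩
  have hF := h.adj hxy (hr.mono (deleteEdges_le _))
  refine deleteEdges_adj.2 ⟨hF, ?_⟩
  rintro rfl
  exact h.not_reachable_deleteEdges hF hr

theorem exists_not_reachable_deleteEdges (h : IsInducedForest G F) (hxy : F.Reachable x y)
    (hne : x ≠ y) : ∃ e ∈ F.edgeSet, ¬ (F.deleteEdges {e}).Reachable x y := by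
  obtain ⟨p, hp⟩ := hxy.exists_isPath
  cases p with
  | nil => exact (hne rfl).elim
  | @cons _ w _ hxw q =>
    rw [Walk.cons_isPath_iff] at hp
    refine ⟨s(x, w), hxw, fun hr => h.not_reachable_deleteEdges hxw (hr.trans ?_)⟩
    have hq : s(x, w) ∉ q.edges := fun hmem => hp.2 (q.fst_mem_support_of_mem_edges hmem)
    exact (q.toDeleteEdge _ hq).reverse.reachable

end IsInducedForest

theorem reachable_of_forall_adj {V' : Type*} {F' : SimpleGraph V'} {m : V → V'}
    (hm : ∀ x y, F.Adj x y → F'.Reachable (m x) (m y)) (h : F.Reachable x y) :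
    F'.Reachable (m x) (m y) := by
  obtain ⟨p⟩ := h
  induction p with
  | nil => exact .refl _
  | cons hab _ ih => exact (hm _ _ hab).trans ih

theorem reachable_iff_of_map {F' : SimpleGraph V} {m : V → V}
    (hmap : ∀ x y, F.Adj x y → F'.Reachable (m x) (m y))
    (hlift : ∀ x y, F'.Adj x y → F.Reachable x y) (hm : ∀ x, F.Reachable x (m x)) :
    F.Reachable x y ↔ F'.Reachable (m x) (m y) :=
  ⟨reachable_of_forall_adj hmap,
    fun h => ((hm x).trans (reachable_of_forall_adj (m := id) hlift h)).trans (hm y).symm⟩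

end InducedForest

section Gain

open SimpleGraph

variable {V : Type*} {G F F' : SimpleGraph V} {ear : Sym2 V → ℕ} {u v : V}

/-- The value of the forest `F`, where `ear e` counts the ears at the edge `e`: virtual vertices of
degree two joined to both ends of `e`. Outside `F` each ear hangs from one end of its edge,
contributing an edge to the forest; if `e` lies in `F`, then its ears are single trees. The number
of edges of the resulting forest is `gain ear F` plus the total number of ears. -/
noncomputable def gain (ear : Sym2 V → ℕ) (F : SimpleGraph V) : ℤ :=
  ∑ᶠ e ∈ F.edgeSet, (1 - (ear e : ℤ))

theorem gain_congr {ear' : Sym2 V → ℕ} (h : ∀ e ∈ F.edgeSet, ear e = ear' e) :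
    gain ear F = gain ear' F :=
  finsum_mem_congr rfl fun e he => by rw [h e he]

variable [Finite V]

theorem gain_sup (h : Disjoint F F') : gain ear (F ⊔ F') = gain ear F + gain ear F' := by
  rw [gain, edgeSet_sup]
  exact finsum_mem_union (disjoint_edgeSet.2 h) (Set.toFinite _) (Set.toFinite _)

theorem gain_sup_edge (huv : u ≠ v) (h : ¬ F.Adj u v) :
    gain ear (F ⊔ edge u v) = gain ear F + (1 - ear s(u, v)) := by
  rw [gain_sup ((disjoint_edge F).2 h)]
  simp only [gain, edgeSet_edge_of_ne huv, finsum_mem_singleton]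

theorem gain_eq_deleteEdges_add (h : F.Adj u v) :
    gain ear F = gain ear (F.deleteEdges {s(u, v)}) + (1 - ear s(u, v)) := by
  have hnadj : ¬ (F.deleteEdges {s(u, v)}).Adj u v := by simp
  rw [← gain_sup_edge h.ne hnadj]
  congr 1
  ext x y
  rw [sup_adj, deleteEdges_adj, adj_edge]
  by_cases hxy : s(u, v) = s(x, y)
  · have := (adj_congr_of_sym2 F hxy).1 h
    simp [this, hxy, this.ne]
  · simp [hxy, Ne.symm hxy]

theorem gain_eq_within_add (v : V) :
    gain ear F = gain ear (within F {v}ᶜ) + ∑ᶠ w ∈ F.neighborSet v, (1 - (ear s(v, w) : ℤ)) := by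
  have hedge : F.edgeSet = (within F {v}ᶜ).edgeSet ∪ (fun w => s(v, w)) '' F.neighborSet v := by
    ext e
    induction e with
    | _ x y =>
      simp only [mem_edgeSet, Set.mem_union, Set.mem_image, mem_neighborSet, Sym2.eq_iff]
      constructor
      · intro hxy
        by_cases hx : x = v
        · exact Or.inr ⟨y, hx ▸ hxy, Or.inl ⟨hx.symm, rfl⟩⟩
        by_cases hy : y = v
        · exact Or.inr ⟨x, hy ▸ hxy.symm, Or.inr ⟨hy.symm, rfl⟩⟩
        · exact Or.inl ⟨hxy, hx, hy⟩
      · rintro (hxy | ⟨w, hw, ⟨rfl, rfl⟩ | ⟨rfl, rfl⟩⟩)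
        exacts [hxy.1, hw, hw.symm]
  have hdisj : Disjoint (within F {v}ᶜ).edgeSet ((fun w => s(v, w)) '' F.neighborSet v) := by
    refine Set.disjoint_right.2 ?_
    rintro _ ⟨w, -, rfl⟩ h
    exact h.2.1 rfl
  rw [gain, hedge, finsum_mem_union hdisj (Set.toFinite _) (Set.toFinite _),
    finsum_mem_image fun a _ b _ hab => Sym2.congr_right.1 hab]
  rfl

theorem gain_le_within_add_one (h : (F.neighborSet v).Subsingleton) :
    gain ear F ≤ gain ear (within F {v}ᶜ) + 1 := by
  rw [gain_eq_within_add v]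
  obtain h | ⟨w, h⟩ := h.eq_empty_or_singleton
  · simp [h]
  · simp [h]

/-- Some edge of the forest `F` has an ear. -/
def HasEaredEdge (ear : Sym2 V → ℕ) (F : SimpleGraph V) : Prop :=
  ∃ e ∈ F.edgeSet, ear e ≠ 0

/-- `F` is an induced forest of `G` of maximal gain. -/
def IsOptimal (G : SimpleGraph V) (ear : Sym2 V → ℕ) (F : SimpleGraph V) : Prop :=
  IsInducedForest G F ∧ ∀ F', IsInducedForest G F' → gain ear F' ≤ gain ear F

theorem exists_isOptimal (G : SimpleGraph V) (ear : Sym2 V → ℕ) : ∃ F, IsOptimal G ear F :=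
  Set.exists_max_image {F | IsInducedForest G F} (gain ear) (Set.toFinite _) ⟨⊥, .bot G⟩

end Gain

section Contraction

open SimpleGraph

variable {V : Type*} {G F F' : SimpleGraph V} {u v t x y : V}

open Classical in
/-- The map sending `v` to `t` and fixing all other vertices. -/
noncomputable def merge (v t : V) : V → V :=
  Function.update id v t

@[simp]
theorem merge_self : merge v t v = t := by
  simp [merge]

theorem merge_of_ne (h : x ≠ v) : merge v t x = x := by
  simp [merge, h]

theorem merge_eq_or (x : V) : merge v t x = x ∨ x = v ∧ merge v t x = t := by
  by_cases hx : x = v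
  · exact Or.inr ⟨hx, hx ▸ merge_self⟩
  · exact Or.inl (merge_of_ne hx)

/-- The graph obtained from `G` by identifying `v` with `t`. To keep the vertex type, `v` stays in
it as an isolated vertex. -/
noncomputable def contract (G : SimpleGraph V) (v t : V) : SimpleGraph V :=
  G.map (merge v t)

theorem reachable_sup_edge_iff (hv : v ∉ F.support) :
    (F ⊔ edge v t).Reachable x y ↔ F.Reachable (merge v t x) (merge v t y) := by
  refine reachable_iff_of_map (fun a b hab => ?_) (fun a b hab => (Adj.reachable (Or.inl hab)))
    fun a => ?_
  · rcases hab with hab | hab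
    · have hne : ∀ {c d}, F.Adj c d → merge v t c = c := fun {c d} hcd =>
        merge_of_ne (ne_of_mem_of_not_mem (F.mem_support.2 ⟨d, hcd⟩) hv)
      rw [hne hab, hne hab.symm]
      exact hab.reachable
    · have ht : merge v t t = t := (merge_eq_or t).elim id And.right
      rcases ((edge_adj ..).1 hab).1 with ⟨rfl, rfl⟩ | ⟨rfl, rfl⟩
      · rw [merge_self, ht]
      · rw [merge_self, ht]
  · obtain h | ⟨rfl, h⟩ := merge_eq_or (v := v) (t := t) a
    · rw [h]
    · rw [h]
      by_cases hat : a = t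
      · rw [hat]
      · exact Adj.reachable (Or.inr ((edge_adj ..).2 ⟨Or.inl ⟨rfl, rfl⟩, hat⟩))

theorem IsInducedForest.sup_edge (h : IsInducedForest G F) (hv : v ∉ F.support)
    (hvt : G.Adj v t) (ht : ∀ y, G.Adj v y → F.Reachable t y → y = t) :
    IsInducedForest G (F ⊔ edge v t) := by
  have hedge : (F ⊔ edge v t).Adj v t := Or.inr ((edge_adj ..).2 ⟨Or.inl ⟨rfl, rfl⟩, hvt.ne⟩)
  refine ⟨h.isAcyclic.sup_edge_of_not_reachable fun hr => hv (mem_support_of_reachable hvt.ne hr),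
    sup_le h.le ((edge_le_iff G).2 (Or.inr hvt)), fun x y hxy hr => ?_⟩
  rw [reachable_sup_edge_iff hv] at hr
  by_cases hx : x = v
  · subst hx
    rw [merge_self, merge_of_ne hxy.ne'] at hr
    rwa [ht y hxy hr]
  by_cases hy : y = v
  · subst hy
    rw [merge_self, merge_of_ne hxy.ne] at hr
    rw [ht x hxy.symm hr.symm]
    exact hedge.symm
  · rw [merge_of_ne hx, merge_of_ne hy] at hr
    exact Or.inl (h.adj hxy hr)

namespace HasNeighbors

theorem contract_eq (h : HasNeighbors G v u t) :
    contract G v t = within G {v}ᶜ ⊔ edge u t := by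
  have hut : ∀ {a}, G.Adj v a → merge v t a ≠ t → a = u := fun hva hne =>
    (h.eq_or_eq _ hva).resolve_right fun hat => hne (by rw [hat, merge_of_ne h.right.ne'])
  ext x y
  rw [contract, map_adj', sup_adj, within_adj, edge_adj]
  constructor
  · rintro ⟨hne, a, b, hab, rfl, rfl⟩
    by_cases ha : a = v
    · subst ha
      rw [merge_self] at hne ⊢
      obtain rfl := hut hab hne.symm
      exact Or.inr ⟨Or.inr ⟨rfl, merge_of_ne h.left.ne'⟩, hne⟩
    by_cases hb : b = v
    · subst hb
      rw [merge_self] at hne ⊢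
      obtain rfl := hut hab.symm hne
      exact Or.inr ⟨Or.inl ⟨merge_of_ne h.left.ne', rfl⟩, hne⟩
    · rw [merge_of_ne ha, merge_of_ne hb]
      exact Or.inl ⟨hab, ha, hb⟩
  · rintro (⟨hxy, hx, hy⟩ | ⟨⟨rfl, rfl⟩ | ⟨rfl, rfl⟩, hne⟩)
    · exact ⟨hxy.ne, x, y, hxy, merge_of_ne hx, merge_of_ne hy⟩
    · exact ⟨hne, x, v, h.left.symm, merge_of_ne h.left.ne', merge_self⟩
    · exact ⟨hne, v, y, h.left, merge_self, merge_of_ne h.left.ne'⟩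

theorem notMem_support_contract (h : HasNeighbors G v u t) : v ∉ (contract G v t).support := by
  rw [h.contract_eq]
  rintro ⟨w, hvw | hvw⟩
  · exact hvw.2.1 rfl
  · rcases ((edge_adj ..).1 hvw).1 with ⟨rfl, -⟩ | ⟨rfl, -⟩
    exacts [h.left.ne rfl, h.right.ne rfl]

theorem contract_adj_iff (h : HasNeighbors G v u t) (hx : x ≠ v) (hy : y ≠ v)
    (hxy : s(x, y) ≠ s(u, t)) : (contract G v t).Adj x y ↔ G.Adj x y := by
  rw [h.contract_eq, sup_adj, adj_edge, within_adj]
  simp [hx, hy, hxy.symm]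

theorem contract_adj_of_adj (h : HasNeighbors G v u t) (hx : x ≠ v) (hy : y ≠ v)
    (hxy : G.Adj x y) : (contract G v t).Adj x y :=
  h.contract_eq ▸ Or.inl ⟨hxy, hx, hy⟩

theorem isInducedForest_of_contract (h : HasNeighbors G v u t)
    (hF' : IsInducedForest (contract G v t) F') (hut : F'.Adj u t → G.Adj u t) :
    IsInducedForest G F' := by
  refine .of_within (S := {v}ᶜ) ⟨hF'.isAcyclic, fun x y hxy => ?_, fun x y hxy hr => ?_⟩
  · have hle := h.contract_eq ▸ hF'.le hxy
    refine hle.elim id fun hedge => ?_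
    rcases ((edge_adj ..).1 hedge).1 with ⟨rfl, rfl⟩ | ⟨rfl, rfl⟩
    · exact ⟨hut hxy, h.left.ne', h.right.ne'⟩
    · exact ⟨(hut hxy.symm).symm, h.right.ne', h.left.ne'⟩
  · exact hF'.adj (h.contract_adj_of_adj hxy.2.1 hxy.2.2 hxy.1) hr

end HasNeighbors

/-- The forest obtained from `F` by replacing the edge `ut` by the path `u v t`. -/
def subdivide (F : SimpleGraph V) (v u t : V) : SimpleGraph V :=
  F.deleteEdges {s(u, t)} ⊔ edge v t ⊔ edge v u

namespace HasNeighbors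

theorem subdivide_adj_left (h : HasNeighbors G v u t) : (subdivide F v u t).Adj v u :=
  Or.inr ((edge_adj ..).2 ⟨Or.inl ⟨rfl, rfl⟩, h.left.ne⟩)

theorem subdivide_adj_right (h : HasNeighbors G v u t) : (subdivide F v u t).Adj v t :=
  Or.inl (Or.inr ((edge_adj ..).2 ⟨Or.inl ⟨rfl, rfl⟩, h.right.ne⟩))

theorem reachable_subdivide_iff (h : HasNeighbors G v u t) (hv : v ∉ F.support)
    (hut : F.Adj u t) : (subdivide F v u t).Reachable x y ↔
      F.Reachable (merge v t x) (merge v t y) := by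
  refine reachable_iff_of_map (fun a b hab => ?_) (fun a b hab => ?_) fun a => ?_
  · rcases hab with (hab | hab) | hab
    · have hF := (deleteEdges_le {s(u, t)}) hab
      rw [merge_of_ne (ne_of_mem_of_not_mem (F.mem_support.2 ⟨b, hF⟩) hv),
        merge_of_ne (ne_of_mem_of_not_mem (F.mem_support.2 ⟨a, hF.symm⟩) hv)]
      exact hF.reachable
    · rcases ((edge_adj ..).1 hab).1 with ⟨rfl, rfl⟩ | ⟨rfl, rfl⟩ <;>
        rw [merge_self, merge_of_ne h.right.ne']
    · rcases ((edge_adj ..).1 hab).1 with ⟨rfl, rfl⟩ | ⟨rfl, rfl⟩ <;>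
        rw [merge_self, merge_of_ne h.left.ne']
      exacts [hut.symm.reachable, hut.reachable]
  · by_cases heq : s(a, b) = s(u, t)
    · have hreach : (subdivide F v u t).Reachable u t :=
        h.subdivide_adj_left.symm.reachable.trans h.subdivide_adj_right.reachable
      rcases Sym2.eq_iff.1 heq with ⟨rfl, rfl⟩ | ⟨rfl, rfl⟩
      exacts [hreach, hreach.symm]
    · exact Adj.reachable (Or.inl (Or.inl (deleteEdges_adj.2 ⟨hab, heq⟩)))
  · obtain ha | ⟨rfl, ha⟩ := merge_eq_or (v := v) (t := t) a
    · rw [ha]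
    · rw [ha]
      exact h.subdivide_adj_right.reachable

theorem isInducedForest_subdivide (h : HasNeighbors G v u t)
    (hF : IsInducedForest (contract G v t) F) (hut : F.Adj u t) (hnut : ¬ G.Adj u t) :
    IsInducedForest G (subdivide F v u t) := by
  have hv : v ∉ F.support := fun hv => h.notMem_support_contract (support_mono hF.le hv)
  have hv' : v ∉ (F.deleteEdges {s(u, t)}).support := fun h =>
    hv (support_mono (deleteEdges_le _) h)
  refine ⟨?_, sup_le (sup_le (fun x y hxy => ?_) ?_) ?_, fun x y hxy hr => ?_⟩
  · refine ((hF.isAcyclic.anti (deleteEdges_le _)).sup_edge_of_not_reachable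
      fun hr => ?_).sup_edge_of_not_reachable fun hr => ?_
    · exact hv' (mem_support_of_reachable h.right.ne hr)
    · rw [reachable_sup_edge_iff hv', merge_self, merge_of_ne h.left.ne'] at hr
      exact isBridge_iff.1 (isAcyclic_iff_forall_adj_isBridge.1 hF.isAcyclic hut) hr.symm
  · rw [deleteEdges_adj] at hxy
    exact (h.contract_adj_iff (ne_of_mem_of_not_mem (F.mem_support.2 ⟨y, hxy.1⟩) hv)
      (ne_of_mem_of_not_mem (F.mem_support.2 ⟨x, hxy.1.symm⟩) hv) hxy.2).1 (hF.le hxy.1)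
  · exact (edge_le_iff G).2 (Or.inr h.right)
  · exact (edge_le_iff G).2 (Or.inr h.left)
  · have hadj_v : ∀ {z}, G.Adj v z → (subdivide F v u t).Adj v z := fun hvz =>
      (h.eq_or_eq _ hvz).elim (fun hz => by rw [hz]; exact h.subdivide_adj_left)
        fun hz => by rw [hz]; exact h.subdivide_adj_right
    by_cases hx : x = v
    · exact hx ▸ hadj_v (hx ▸ hxy)
    by_cases hy : y = v
    · exact hy ▸ (hadj_v (hy ▸ hxy.symm)).symm
    rw [h.reachable_subdivide_iff hv hut, merge_of_ne hx, merge_of_ne hy] at hr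
    refine Or.inl (Or.inl (deleteEdges_adj.2
      ⟨hF.adj (h.contract_adj_of_adj hx hy hxy) hr, fun heq => hnut ?_⟩))
    exact (adj_congr_of_sym2 G heq).1 hxy

theorem isInducedForest_contract (h : HasNeighbors G v u t)
    (hF : IsInducedForest (within G {v}ᶜ) F) (hut : F.Reachable u t → F.Adj u t ∨ u = t) :
    IsInducedForest (contract G v t) F := by
  refine ⟨hF.isAcyclic, hF.le.trans (h.contract_eq ▸ le_sup_left), fun x y hxy hr => ?_⟩
  rw [h.contract_eq] at hxy
  refine hxy.elim (fun hG => hF.adj hG hr) fun hedge => ?_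
  obtain ⟨⟨rfl, rfl⟩ | ⟨rfl, rfl⟩, hne⟩ := (edge_adj ..).1 hedge
  · exact (hut hr).resolve_right hne
  · exact ((hut hr.symm).resolve_right hne.symm).symm

theorem isInducedForest_contract_sup_edge (h : HasNeighbors G v u t) (hF : IsInducedForest G F)
    (hvu : F.Adj v u) (hvt : F.Adj v t) :
    IsInducedForest (contract G v t) (within F {v}ᶜ ⊔ edge u t) := by
  have hle : within F {v}ᶜ ⊔ edge u t ≤ contract G v t := h.contract_eq ▸
    sup_le_sup_right (within_mono hF.le) _
  refine ⟨?_, hle, fun x y hxy hr => ?_⟩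
  · by_cases hut : u = t
    · rw [hut, edge_self_eq_bot, sup_bot_eq]
      exact hF.isAcyclic.anti within_le
    refine (hF.isAcyclic.anti within_le).sup_edge_of_not_reachable fun hr => ?_
    refine hF.not_reachable_deleteEdges hvt (.trans (v := u) (Adj.reachable ?_) (hr.mono ?_))
    · simp [hvu, hut, hvt.ne]
    · intro a b hab
      refine deleteEdges_adj.2 ⟨hab.1, fun heq => ?_⟩
      rcases Sym2.eq_iff.1 heq with ⟨hav, -⟩ | ⟨-, hbv⟩
      exacts [hab.2.1 hav, hab.2.2 hbv]
  · rw [h.contract_eq] at hxy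
    refine hxy.elim (fun hG => Or.inl ⟨hF.adj hG.1 ?_, hG.2⟩) Or.inr
    refine reachable_of_forall_adj (m := id) (fun a b hab => ?_) hr
    refine hab.elim (fun hF => hF.1.reachable) fun hedge => ?_
    have hreach : F.Reachable u t := hvu.symm.reachable.trans hvt.reachable
    rcases ((edge_adj ..).1 hedge).1 with ⟨rfl, rfl⟩ | ⟨rfl, rfl⟩
    exacts [hreach, hreach.symm]

end HasNeighbors

end Contraction

section ContractGain

open SimpleGraph

variable {V : Type*} {G F F' : SimpleGraph V} {ear : Sym2 V → ℕ} {u v t : V}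

open Classical in
/-- The ear counts on `contract G v t` for a vertex `v` with neighbours `u` and `t` and no ear at
`vt`. If `ut` is an edge of `G`, then `v` becomes an ear at `ut`; otherwise `ut` takes over the ears
at `vu`. -/
noncomputable def contractEar (G : SimpleGraph V) (ear : Sym2 V → ℕ) (v u t : V) : Sym2 V → ℕ :=
  Function.update ear s(u, t) (if G.Adj u t then ear s(u, t) + 1 else ear s(v, u))

theorem contractEar_of_ne {e : Sym2 V} (he : e ≠ s(u, t)) : contractEar G ear v u t e = ear e := by
  simp [contractEar, he]

theorem contractEar_of_adj (h : G.Adj u t) :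
    contractEar G ear v u t s(u, t) = ear s(u, t) + 1 := by
  simp [contractEar, h]

theorem contractEar_of_not_adj (h : ¬ G.Adj u t) :
    contractEar G ear v u t s(u, t) = ear s(v, u) := by
  simp [contractEar, h]

theorem gain_contractEar (hF : ¬ F.Adj u t) :
    gain (contractEar G ear v u t) F = gain ear F :=
  gain_congr fun _ he => contractEar_of_ne (ne_of_mem_of_not_mem he hF)

theorem HasNeighbors.subsingleton_neighborSet (h : HasNeighbors G v u t) (hle : F ≤ G)
    (hut : u ≠ t → F.Adj v u → ¬ F.Adj v t) : (F.neighborSet v).Subsingleton := fun a ha b hb => by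
  by_contra hab
  rcases h.eq_or_eq a (hle ha) with rfl | rfl <;> rcases h.eq_or_eq b (hle hb) with rfl | rfl
  exacts [hab rfl, hut hab ha hb, hut (Ne.symm hab) hb ha, hab rfl]

variable [Finite V]

theorem gain_contractEar_of_adj (hF : F.Adj u t) (hG : G.Adj u t) :
    gain (contractEar G ear v u t) F + 1 = gain ear F := by
  have hdel : ¬ (F.deleteEdges {s(u, t)}).Adj u t := by simp
  rw [gain_eq_deleteEdges_add hF, gain_eq_deleteEdges_add (ear := ear) hF, gain_contractEar hdel,
    contractEar_of_adj hG]
  push_cast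
  ring

namespace HasNeighbors

theorem gain_subdivide (h : HasNeighbors G v u t) (hvt : ear s(v, t) = 0) (hv : v ∉ F.support)
    (hF : F.Adj u t) (hG : ¬ G.Adj u t) :
    gain ear (subdivide F v u t) = gain (contractEar G ear v u t) F + 1 := by
  have hdel : ¬ (F.deleteEdges {s(u, t)}).Adj u t := by simp
  have hvF : ∀ w, ¬ F.Adj v w := fun w hw => hv ⟨w, hw⟩
  have hvt' : ¬ (F.deleteEdges {s(u, t)}).Adj v t := fun hadj => hvF t (deleteEdges_le _ hadj)
  have hvu : ¬ (F.deleteEdges {s(u, t)} ⊔ edge v t).Adj v u := by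
    rintro (hadj | hadj)
    · exact hvF u (deleteEdges_le _ hadj)
    · rcases ((edge_adj ..).1 hadj).1 with ⟨-, rfl⟩ | ⟨hv, -⟩
      exacts [hF.ne rfl, h.right.ne hv]
  rw [subdivide, gain_sup_edge h.left.ne hvu, gain_sup_edge h.right.ne hvt',
    gain_eq_deleteEdges_add hF, gain_contractEar hdel, contractEar_of_not_adj hG, hvt]
  push_cast
  ring

theorem exists_isInducedForest_of_contract (h : HasNeighbors G v u t) (hvt : ear s(v, t) = 0)
    (hF' : IsInducedForest (contract G v t) F') (hut : ¬ (F'.Adj u t ∧ G.Adj u t)) :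
    ∃ F, IsInducedForest G F ∧
      (∀ x y, F.Reachable x y ↔ F'.Reachable (merge v t x) (merge v t y)) ∧
      gain ear F = gain (contractEar G ear v u t) F' + 1 ∧
      (HasEaredEdge (contractEar G ear v u t) F' → HasEaredEdge ear F) := by
  have hv : v ∉ F'.support := fun hv => h.notMem_support_contract (support_mono hF'.le hv)
  by_cases hadj : F'.Adj u t
  · have hG : ¬ G.Adj u t := fun hG => hut ⟨hadj, hG⟩
    refine ⟨subdivide F' v u t, h.isInducedForest_subdivide hF' hadj hG,
      fun _ _ => h.reachable_subdivide_iff hv hadj, h.gain_subdivide hvt hv hadj hG, ?_⟩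
    rintro ⟨e, he, hear⟩
    by_cases heq : e = s(u, t)
    · rw [heq, contractEar_of_not_adj hG] at hear
      exact ⟨s(v, u), h.subdivide_adj_left, hear⟩
    · rw [contractEar_of_ne heq] at hear
      exact ⟨e, edgeSet_mono (le_sup_left.trans le_sup_left) (by simp [he, heq]), hear⟩
  · have hforest : IsInducedForest G F' := h.isInducedForest_of_contract hF' fun h => (hadj h).elim
    refine ⟨F' ⊔ edge v t, hforest.sup_edge hv h.right fun y hvy hty => ?_,
      fun _ _ => reachable_sup_edge_iff hv, ?_, ?_⟩
    · by_contra hyt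
      obtain rfl := (h.eq_or_eq y hvy).resolve_right hyt
      refine hadj (hF'.adj ?_ hty.symm)
      exact h.contract_eq ▸ Or.inr ((edge_adj ..).2 ⟨Or.inl ⟨rfl, rfl⟩, hyt⟩)
    · rw [gain_sup_edge h.right.ne fun hvt => hv ⟨t, hvt⟩, gain_contractEar hadj, hvt]
      simp
    · rintro ⟨e, he, hear⟩
      rw [contractEar_of_ne (ne_of_mem_of_not_mem he hadj)] at hear
      exact ⟨e, edgeSet_mono le_sup_left he, hear⟩

theorem exists_contract_of_adj (h : HasNeighbors G v u t) (hF : IsInducedForest G F)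
    (hut : G.Adj u t) : ∃ F', IsInducedForest (contract G v t) F' ∧
      gain ear F ≤ gain (contractEar G ear v u t) F' + 1 := by
  refine ⟨within F {v}ᶜ, h.isInducedForest_contract (hF.within_within _) fun hr =>
    Or.inl ((hF.within_within _).adj ⟨hut, h.left.ne', h.right.ne'⟩ hr), ?_⟩
  by_cases hF' : F.Adj u t
  · have hempty : F.neighborSet v = ∅ := by
      refine Set.eq_empty_of_forall_notMem fun w hw => ?_
      rcases h.eq_or_eq w (hF.le hw) with rfl | rfl
      · exact hF.not_adj_of_adj_adj hw.symm hF' h.right.ne h.right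
      · exact hF.not_adj_of_adj_adj hw.symm hF'.symm h.left.ne h.left
    rw [gain_contractEar_of_adj
      (within_adj.2 ⟨hF', h.left.ne', h.right.ne'⟩) hut, gain_eq_within_add v, hempty,
      finsum_mem_empty, add_zero]
  · rw [gain_contractEar fun hadj : (within F {v}ᶜ).Adj u t => hF' hadj.1]
    exact gain_le_within_add_one <| h.subsingleton_neighborSet hF.le fun hne hvu hvt =>
      hF.not_adj_of_adj_adj hvu hvt hne hut

theorem exists_contract_of_adj_adj (h : HasNeighbors G v u t) (hvt : ear s(v, t) = 0)
    (hF : IsInducedForest G F) (hne : u ≠ t) (hFu : F.Adj v u) (hFt : F.Adj v t) :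
    ∃ F', IsInducedForest (contract G v t) F' ∧
      gain ear F ≤ gain (contractEar G ear v u t) F' + 1 := by
  refine ⟨_, h.isInducedForest_contract_sup_edge hF hFu hFt, ?_⟩
  have hut : ¬ G.Adj u t := hF.not_adj_of_adj_adj hFu hFt hne
  have hnadj : ¬ (within F {v}ᶜ).Adj u t := fun hadj => hut (hF.le hadj.1)
  have hnbr : F.neighborSet v = {u, t} := Set.ext fun w =>
    ⟨fun hw => h.eq_or_eq w (hF.le hw), by rintro (rfl | rfl); exacts [hFu, hFt]⟩
  rw [gain_sup_edge hne hnadj, gain_contractEar hnadj, contractEar_of_not_adj hut,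
    gain_eq_within_add v, hnbr, finsum_mem_pair hne, hvt]
  push_cast
  linarith

theorem exists_contract_of_reachable (h : HasNeighbors G v u t) (hF : IsInducedForest G F)
    (hut : ¬ G.Adj u t) (hne : u ≠ t) (hboth : F.Adj v u → ¬ F.Adj v t)
    (hr : (within F {v}ᶜ).Reachable u t) :
    ∃ F', IsInducedForest (contract G v t) F' ∧
      gain ear F ≤ gain (contractEar G ear v u t) F' + 1 := by
  have hD := hF.within_within {v}ᶜ
  have hFr : F.Reachable u t := hr.mono within_le
  have hempty : F.neighborSet v = ∅ := Set.eq_empty_of_forall_notMem fun w hw => by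
    rcases h.eq_or_eq w (hF.le hw) with rfl | rfl
    · exact hboth hw (hF.adj h.right (hw.reachable.trans hFr))
    · exact hboth (hF.adj h.left (hw.reachable.trans hFr.symm)) hw
  obtain ⟨e, he, hsep⟩ := hD.exists_not_reachable_deleteEdges hr hne
  refine ⟨_, h.isInducedForest_contract (hD.deleteEdges e) fun hr => (hsep hr).elim, ?_⟩
  induction e with
  | _ x y =>
    rw [gain_eq_within_add v, hempty, finsum_mem_empty, add_zero,
      ← gain_contractEar (G := G) (v := v) fun hadj : (within F {v}ᶜ).Adj u t => hut (hF.le hadj.1),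
      gain_eq_deleteEdges_add he]
    linarith [Int.natCast_nonneg (contractEar G ear v u t s(x, y))]

theorem exists_contract_of_not_adj (h : HasNeighbors G v u t) (hvt : ear s(v, t) = 0)
    (hF : IsInducedForest G F) (hut : ¬ G.Adj u t) :
    ∃ F', IsInducedForest (contract G v t) F' ∧
      gain ear F ≤ gain (contractEar G ear v u t) F' + 1 := by
  by_cases hboth : u ≠ t ∧ F.Adj v u ∧ F.Adj v t
  · exact h.exists_contract_of_adj_adj hvt hF hboth.1 hboth.2.1 hboth.2.2
  by_cases hr : (within F {v}ᶜ).Reachable u t → u = t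
  · refine ⟨_, h.isInducedForest_contract (hF.within_within _) fun hr' => Or.inr (hr hr'), ?_⟩
    rw [gain_contractEar fun hadj : (within F {v}ᶜ).Adj u t => hut (hF.le hadj.1)]
    exact gain_le_within_add_one <| h.subsingleton_neighborSet hF.le fun hne hvu hvt =>
      hboth ⟨hne, hvu, hvt⟩
  · push Not at hr
    exact h.exists_contract_of_reachable hF hut hr.2 (fun hvu hvt => hboth ⟨hr.2, hvu, hvt⟩) hr.1

end HasNeighbors

end ContractGain

section Pendant

open SimpleGraph

variable {V : Type*} {G F F' : SimpleGraph V} {u v t r x y : V}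

/-- The components of `x` and `y` in `F` are distinct and joined by an edge of `G`. -/
def Linked (G F : SimpleGraph V) (x y : V) : Prop :=
  ¬ F.Reachable x y ∧ ∃ p q, F.Reachable x p ∧ F.Reachable y q ∧ G.Adj p q

theorem Linked.symm (h : Linked G F x y) : Linked G F y x := by
  obtain ⟨hr, p, q, hp, hq, hpq⟩ := h
  exact ⟨fun h => hr h.symm, q, p, hq, hp, hpq.symm⟩

theorem Linked.mem_support (h : Linked G F x y) (hle : F ≤ G) : x ∈ G.support := by
  obtain ⟨-, p, q, hp, -, hpq⟩ := h
  by_cases hxp : x = p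
  · exact ⟨q, hxp ▸ hpq⟩
  · exact support_mono hle (mem_support_of_reachable hxp hp)

/-- Some component of `F` that does not contain the root `r` is linked to exactly one other
component. -/
def HasPendant (G F : SimpleGraph V) (r : V) : Prop :=
  ∃ x y, ¬ F.Reachable x r ∧ Linked G F x y ∧ ∀ z, Linked G F x z → F.Reachable y z

theorem linked_map_iff {V' : Type*} {F' : SimpleGraph V'} {m : V → V'}
    (hF : ∀ x y, F.Reachable x y ↔ F'.Reachable (m x) (m y)) :
    Linked (G.map m) F' (m x) (m y) ↔ Linked G F x y := by
  rw [Linked, Linked, ← hF]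
  refine and_congr_right fun hr => ⟨?_, ?_⟩
  · rintro ⟨_, _, hp, hq, -, p, q, hpq, rfl, rfl⟩
    exact ⟨p, q, (hF _ _).2 hp, (hF _ _).2 hq, hpq⟩
  · rintro ⟨p, q, hp, hq, hpq⟩
    refine ⟨m p, m q, (hF _ _).1 hp, (hF _ _).1 hq, fun hpq => hr ?_, p, q, hpq, rfl, rfl⟩
    exact (hF _ _).2 (((hF _ _).1 hp).trans (hpq ▸ ((hF _ _).1 hq).symm))

namespace HasNeighbors

theorem hasPendant_of_contract (h : HasNeighbors G v u t) (hle : F' ≤ contract G v t)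
    (hF : ∀ x y, F.Reachable x y ↔ F'.Reachable (merge v t x) (merge v t y)) (hr : r ≠ v)
    (hF' : HasPendant (contract G v t) F' r) : HasPendant G F r := by
  obtain ⟨x, y, hxr, hxy, huniq⟩ := hF'
  have hx : merge v t x = x := merge_of_ne <|
    ne_of_mem_of_not_mem (hxy.mem_support hle) h.notMem_support_contract
  have hy : merge v t y = y := merge_of_ne <|
    ne_of_mem_of_not_mem (hxy.symm.mem_support hle) h.notMem_support_contract
  refine ⟨x, y, ?_, (linked_map_iff hF).1 (by rwa [hx, hy]), fun z hz => ?_⟩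
  · rwa [hF, hx, merge_of_ne hr]
  · rw [hF, hy]
    exact huniq _ (hx ▸ (linked_map_iff hF).2 hz)

theorem hasPendant_of_notMem_support (h : HasNeighbors G v u t) (hv : v ∉ F.support)
    (hut : F.Reachable u t) (hr : r ≠ v) : HasPendant G F r := by
  have hne : ∀ x, F.Reachable v x → x = v := fun x hx => by
    by_contra hxv
    exact hv (mem_support_of_reachable (Ne.symm hxv) hx)
  refine ⟨v, u, fun hvr => hr (hne r hvr),
    ⟨fun hvu => h.left.ne' (hne u hvu), v, u, .refl v, .refl u, h.left⟩, ?_⟩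
  rintro z ⟨-, p, q, hp, hq, hpq⟩
  obtain rfl := hne p hp
  obtain rfl | rfl := h.eq_or_eq q hpq
  exacts [hq.symm, hut.trans hq.symm]

end HasNeighbors

end Pendant

section EaredMinor

open SimpleGraph

variable {V W : Type*} {G G' : SimpleGraph V} {H : SimpleGraph W} {B : W → Set V}
  {ear : Sym2 V → ℕ} {u v t r : V}

/-- `G` has a minor `K_{2,3}` in which, if the two vertices of degree three are represented through
an edge of `G`, the ears at this edge may serve as vertices of degree two. -/
def HasEaredK23 (G : SimpleGraph V) (ear : Sym2 V → ℕ) : Prop :=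
  ∃ (n : ℕ) (B : Fin 2 ⊕ Fin (n + 1) → Set V),
    IsMinorModel (completeBipartiteGraph (Fin 2) (Fin (n + 1))) G B ∧
      (2 ≤ n ∨ ∃ a ∈ B (.inl 0), ∃ b ∈ B (.inl 1), G.Adj a b ∧ 2 ≤ n + ear s(a, b))

/-- The graph `G` together with its ears contains a cycle. -/
def HasEaredCycle (G : SimpleGraph V) (ear : Sym2 V → ℕ) : Prop :=
  ¬ G.IsAcyclic ∨ HasEaredEdge ear G

theorem HasEaredK23.mono (h : HasEaredK23 G ear) (hle : G ≤ G') :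
    HasEaredK23 G' ear := by
  obtain ⟨n, B, hB, hn⟩ := h
  refine ⟨n, B, hB.mono hle, hn.imp_right ?_⟩
  rintro ⟨a, ha, b, hb, hab, hn⟩
  exact ⟨a, ha, b, hb, hle hab, hn⟩

theorem HasEaredCycle.ne_bot (h : HasEaredCycle G ear) : G ≠ ⊥ := by
  rintro rfl
  obtain h | ⟨e, he, -⟩ := h
  · exact h isAcyclic_bot
  · simp at he

theorem notMem_of_connected_induce {S : Set V} {x : V} (h : (G.induce S).Connected)
    (hx : x ∈ S) (hxG : x ∈ G.support) (hv : v ∉ G.support) : v ∉ S := by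
  intro hvS
  have hr := ((h.preconnected ⟨v, hvS⟩ ⟨x, hx⟩).map (Embedding.induce S).toHom)
  exact hv (mem_support_of_reachable (ne_of_mem_of_not_mem hxG hv).symm hr)

theorem IsMinorModel.notMem_of_notMem_support (h : IsMinorModel H G B) (hH : ∀ i, ∃ j, H.Adj i j)
    (hv : v ∉ G.support) (i : W) : v ∉ B i := by
  obtain ⟨j, hij⟩ := hH i
  obtain ⟨a, ha, b, -, hab⟩ := h.adjacent i j hij
  exact notMem_of_connected_induce (h.connected i) ha ⟨b, hab⟩ hv

namespace HasNeighbors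

theorem connected_induce_preimage_merge (h : HasNeighbors G v u t) {S : Set V} (hv : v ∉ S)
    (hS : ((contract G v t).induce S).Connected) :
    (G.induce (merge v t ⁻¹' S)).Connected := by
  let incl (x : S) : merge v t ⁻¹' S :=
    ⟨x, by rw [Set.mem_preimage, merge_of_ne (ne_of_mem_of_not_mem x.2 hv)]; exact x.2⟩
  have hmerge : ∀ a (ha : merge v t a ∈ S),
      (G.induce (merge v t ⁻¹' S)).Reachable (incl ⟨merge v t a, ha⟩) ⟨a, ha⟩ := by
    intro a ha
    obtain hax | ⟨rfl, _⟩ := merge_eq_or (v := v) (t := t) a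
    · simp only [incl, hax, Reachable.refl]
    · exact Adj.reachable (by simpa [incl] using h.right.symm)
  have hincl : ∀ x y, ((contract G v t).induce S).Reachable x y →
      (G.induce (merge v t ⁻¹' S)).Reachable (incl x) (incl y) := fun x y => by
    refine reachable_of_forall_adj (m := incl) ?_
    rintro ⟨_, hx⟩ ⟨_, hy⟩ ⟨-, a, b, hab, rfl, rfl⟩
    have hab' : (G.induce (merge v t ⁻¹' S)).Adj ⟨a, hx⟩ ⟨b, hy⟩ := hab
    exact ((hmerge a hx).trans hab'.reachable).trans (hmerge b hy).symm
  refine (connected_iff _).2 ⟨fun a b => ?_, hS.nonempty.map incl⟩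
  exact ((hmerge a a.2).symm.trans (hincl _ _ (hS.preconnected _ _))).trans (hmerge b b.2)

theorem isMinorModel_preimage_merge (h : HasNeighbors G v u t)
    (hB : IsMinorModel H (contract G v t) B) (hH : ∀ i, ∃ j, H.Adj i j) :
    IsMinorModel H G fun i => merge v t ⁻¹' B i := by
  refine ⟨fun i => h.connected_induce_preimage_merge
    (hB.notMem_of_notMem_support hH h.notMem_support_contract i) (hB.connected i),
    fun i j hij => (hB.disjoint i j hij).preimage _, fun i j hij => ?_⟩
  obtain ⟨_, ha, _, hb, -, a, b, hab, rfl, rfl⟩ := hB.adjacent i j hij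
  exact ⟨a, ha, b, hb, hab⟩

end HasNeighbors

theorem IsMinorModel.cons {k n : ℕ} {B : Fin k ⊕ Fin n → Set V} {C : Set V}
    (h : IsMinorModel (completeBipartiteGraph (Fin k) (Fin n)) G B)
    (hC : (G.induce C).Connected) (hdisj : ∀ i, Disjoint (B i) C)
    (hadj : ∀ i, G.AdjacentTrees (B (.inl i)) C) :
    IsMinorModel (completeBipartiteGraph (Fin k) (Fin (n + 1))) G
      (Sum.elim (B ∘ .inl) (Fin.cons C (B ∘ .inr))) := by
  constructor
  · rintro (i | i)
    · exact h.connected (.inl i)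
    · exact Fin.cases hC (fun i => h.connected (.inr i)) i
  · rintro (i | i) (j | j) hij
    · exact h.disjoint (.inl i) (.inl j) fun heq => hij (congrArg _ (Sum.inl_injective heq))
    · exact Fin.cases (hdisj (.inl i)) (fun j => h.disjoint _ _ Sum.inl_ne_inr) j
    · exact Fin.cases (hdisj (.inl j)).symm (fun i => h.disjoint _ _ Sum.inr_ne_inl) i
    · induction i using Fin.cases <;> induction j using Fin.cases
      exacts [(hij rfl).elim, (hdisj (.inr _)).symm, hdisj (.inr _),
        h.disjoint _ _ fun heq => hij (congrArg _ (congrArg Fin.succ (Sum.inr_injective heq)))]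
  · have hadj' : ∀ i j,
        G.AdjacentTrees (B (.inl i)) ((Fin.cons C (B ∘ .inr) : Fin (n + 1) → _) j) := fun i =>
      Fin.cases (hadj i) fun j => h.adjacent (.inl i) (.inr j) (by simp)
    rintro (i | i) (j | j) hij
    · simp at hij
    · exact hadj' i j
    · exact adjacentTrees_comm.1 (hadj' j i)
    · simp at hij

namespace HasNeighbors

theorem isMinor_of_contract (h : HasNeighbors G v u t) (hH : ∀ i, ∃ j, H.Adj i j)
    (hK : IsMinor H (contract G v t)) : IsMinor H G := by
  obtain ⟨B, hB⟩ := hK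
  exact ⟨_, h.isMinorModel_preimage_merge hB hH⟩

theorem hasEaredK23_of_contract (h : HasNeighbors G v u t)
    (hK : HasEaredK23 (contract G v t) (contractEar G ear v u t)) : HasEaredK23 G ear := by
  obtain ⟨n, B, hB, hn⟩ := hK
  have hH : ∀ i, ∃ j, (completeBipartiteGraph (Fin 2) (Fin (n + 1))).Adj i j := by
    rintro (i | i)
    exacts [⟨.inr 0, by simp⟩, ⟨.inl 0, by simp⟩]
  have hv := hB.notMem_of_notMem_support hH h.notMem_support_contract
  have hmem : ∀ {i x}, x ∈ B i → x ∈ merge v t ⁻¹' B i := fun {i x} hx => by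
    rwa [Set.mem_preimage, merge_of_ne (ne_of_mem_of_not_mem hx (hv i))]
  have hB' := h.isMinorModel_preimage_merge hB hH
  obtain hn | ⟨a, ha, b, hb, hab, hn⟩ := hn
  · exact ⟨n, _, hB', Or.inl hn⟩
  by_cases hne : s(a, b) ≠ s(u, t)
  · rw [contractEar_of_ne hne] at hn
    rw [h.contract_adj_iff (ne_of_mem_of_not_mem ha (hv _)) (ne_of_mem_of_not_mem hb (hv _)) hne]
      at hab
    exact ⟨n, _, hB', Or.inr ⟨a, hmem ha, b, hmem hb, hab, hn⟩⟩
  push Not at hne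
  by_cases hut : G.Adj u t
  · rw [hne, contractEar_of_adj hut, ← hne] at hn
    have hle : contract G v t ≤ G :=
      h.contract_eq ▸ sup_le within_le ((edge_le_iff G).2 (Or.inr hut))
    have hadj : G.Adj a v ∧ G.Adj b v := by
      rcases Sym2.eq_iff.1 hne with ⟨rfl, rfl⟩ | ⟨rfl, rfl⟩
      exacts [⟨h.left.symm, h.right.symm⟩, ⟨h.right.symm, h.left.symm⟩]
    refine ⟨n + 1, _, (hB.mono hle).cons (C := {v}) .of_subsingleton
      (fun i => Set.disjoint_singleton_right.2 (hv i)) ?_,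
      Or.inr ⟨a, ha, b, hb, hle hab, by lia⟩⟩
    exact Fin.forall_fin_two.2 ⟨⟨a, ha, v, rfl, hadj.1⟩, ⟨b, hb, v, rfl, hadj.2⟩⟩
  · rw [hne, contractEar_of_not_adj hut] at hn
    refine ⟨n, _, hB', Or.inr ?_⟩
    rcases Sym2.eq_iff.1 hne with ⟨rfl, rfl⟩ | ⟨rfl, rfl⟩
    · exact ⟨a, hmem ha, v, by simpa using hb, h.left.symm, by rwa [Sym2.eq_swap]⟩
    · exact ⟨v, by simpa using ha, b, hmem hb, h.left, hn⟩

theorem hasEaredEdge_contract (h : HasNeighbors G v u t) (hvt : ear s(v, t) = 0)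
    (hG : HasEaredEdge ear G) : HasEaredEdge (contractEar G ear v u t) (contract G v t) := by
  have hv : ∀ {x}, G.Adj v x → ear s(v, x) ≠ 0 →
      HasEaredEdge (contractEar G ear v u t) (contract G v t) := fun {x} hvx hear => by
    have hxt : x ≠ t := by
      rintro rfl
      exact hear hvt
    obtain rfl := (h.eq_or_eq x hvx).resolve_right hxt
    refine ⟨s(x, t), h.contract_eq ▸ Or.inr ((edge_adj ..).2 ⟨Or.inl ⟨rfl, rfl⟩, hxt⟩), ?_⟩
    by_cases hG : G.Adj x t
    · simp [contractEar_of_adj hG]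
    · rwa [contractEar_of_not_adj hG]
  obtain ⟨e, he, hear⟩ := hG
  induction e with
  | _ x y =>
    by_cases hxv : x = v
    · subst hxv
      exact hv he hear
    by_cases hyv : y = v
    · subst hyv
      exact hv he.symm (by rwa [Sym2.eq_swap])
    refine ⟨s(x, y), h.contract_adj_of_adj hxv hyv he, ?_⟩
    by_cases heq : s(x, y) = s(u, t)
    · rw [heq, contractEar_of_adj ((adj_congr_of_sym2 G heq).1 he)]
      exact Nat.succ_ne_zero _
    · rwa [contractEar_of_ne heq]

theorem hasEaredCycle_contract [Finite V] (h : HasNeighbors G v u t) (hvt : ear s(v, t) = 0)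
    (hG : HasEaredCycle G ear) :
    HasEaredCycle (contract G v t) (contractEar G ear v u t) := by
  by_contra hcon
  rw [HasEaredCycle, not_or, not_not] at hcon
  obtain ⟨hac, hear⟩ := hcon
  have hforest : IsInducedForest (contract G v t) (contract G v t) :=
    ⟨hac, le_rfl, fun _ _ hxy _ => hxy⟩
  have hut : ¬ ((contract G v t).Adj u t ∧ G.Adj u t) := fun ⟨hadj, hut⟩ =>
    hear ⟨s(u, t), hadj, by simp [contractEar_of_adj hut]⟩
  obtain ⟨F, hF, hreach, -, -⟩ := h.exists_isInducedForest_of_contract hvt hforest hut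
  have hle : G ≤ F := fun x y hxy => hF.adj hxy <| (hreach x y).2 <| by
    by_cases hne : merge v t x = merge v t y
    · rw [hne]
    · exact Adj.reachable (map_adj_apply' hxy hne)
  obtain hG | ⟨e, he, hpos⟩ := hG
  · exact hG (hF.isAcyclic.anti hle)
  · exact hear (h.hasEaredEdge_contract hvt ⟨e, he, hpos⟩)

theorem support_contract_ssubset (h : HasNeighbors G v u t) :
    (contract G v t).support ⊂ G.support := by
  refine ⟨?_, fun hsub => h.notMem_support_contract (hsub ⟨u, h.left⟩)⟩
  rintro _ ⟨_, -, a, b, hab, rfl, rfl⟩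
  obtain ha | ⟨rfl, ha⟩ := merge_eq_or (v := v) (t := t) a
  · rw [ha]
    exact ⟨b, hab⟩
  · rw [ha]
    exact ⟨_, h.right.symm⟩

theorem not_reachable_within_of_two_le (h : HasNeighbors G v u t) (hut : u ≠ t)
    (hear : 2 ≤ ear s(v, u)) (hK : ¬ HasEaredK23 G ear) : ¬ (within G {v}ᶜ).Reachable u t := by
  classical
  intro hr
  obtain ⟨p, hp⟩ := hr.exists_isPath
  cases p with
  | nil => exact hut rfl
  | @cons _ w _ huw q =>
    rw [Walk.cons_isPath_iff] at hp
    have hvq : v ∉ q.support := fun hmem =>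
      mem_of_reachable_within (q.takeUntil v hmem).reverse.reachable (Ne.symm huw.2.2) rfl
    have hconn : (G.induce {x | x ∈ q.support}).Connected := by
      rw [← q.support_mapLe_eq_support (within_le (G := G))]
      exact Walk.connected_induce_support _
    have hbase : IsMinorModel (completeBipartiteGraph (Fin 2) (Fin 0)) G
        (Sum.elim ![{v}, {u}] Fin.elim0) := by
      refine ⟨?_, ?_, ?_⟩
      · simp
      · simpa [Fin.forall_fin_two] using ⟨h.left.ne', h.left.ne⟩
      · simp
    refine hK ⟨0, _, hbase.cons hconn ?_ ?_,
      Or.inr ⟨v, rfl, u, rfl, h.left, by simpa using hear⟩⟩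
    · simpa [Fin.forall_fin_two] using ⟨hvq, hp.2⟩
    · exact Fin.forall_fin_two.2 ⟨⟨v, rfl, t, q.end_mem_support, h.right⟩,
        ⟨u, rfl, w, q.start_mem_support, huw.1⟩⟩

end HasNeighbors

end EaredMinor

section Separation

open SimpleGraph

variable {V : Type*} {G F F₀ F₁ : SimpleGraph V} {ear : Sym2 V → ℕ} {S : Set V} {u v x y : V}

theorem within_sup_within_compl (hS : ∀ x y, F.Adj x y → x ∈ S → y ∈ S) :
    within F S ⊔ within F Sᶜ = F := by
  refine le_antisymm (sup_le within_le within_le) fun x y hxy => ?_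
  by_cases hx : x ∈ S
  · exact Or.inl ⟨hxy, hx, hS x y hxy hx⟩
  · exact Or.inr ⟨hxy, hx, fun hy => hx (hS y x hxy.symm hy)⟩

theorem disjoint_of_le_within (h₀ : F₀ ≤ within G S) (h₁ : F₁ ≤ within G Sᶜ) : Disjoint F₀ F₁ :=
  disjoint_left.2 fun _ _ hS hSc => (h₁ hSc).2.1 (h₀ hS).2.1

theorem reachable_of_sup (h₀ : F₀ ≤ within G S) (h₁ : F₁ ≤ within G Sᶜ) (hx : x ∈ S)
    (h : (F₀ ⊔ F₁).Reachable x y) : F₀.Reachable x y := by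
  obtain ⟨p⟩ := h
  induction p with
  | nil => exact .refl _
  | cons hab _ ih =>
    have hab₀ := hab.resolve_right fun hab₁ => (h₁ hab₁).2.1 hx
    exact hab₀.reachable.trans (ih (h₀ hab₀).2.2)

theorem mem_of_reachable_sup (h₀ : F₀ ≤ within G S) (h₁ : F₁ ≤ within G Sᶜ) (hx : x ∈ S)
    (h : (F₀ ⊔ F₁).Reachable x y) : y ∈ S := by
  obtain rfl | hxy := eq_or_ne x y
  · exact hx
  · exact mem_of_reachable_within ((reachable_of_sup h₀ h₁ hx h).symm.mono h₀) hxy.symm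

theorem not_reachable_sup_deleteEdges (h₀ : IsInducedForest (within G S) F₀)
    (h₁ : F₁ ≤ within G Sᶜ) (hxy : F₀.Adj x y) :
    ¬ ((F₀ ⊔ F₁).deleteEdges {s(x, y)}).Reachable x y := by
  intro hr
  rw [deleteEdges_sup] at hr
  exact h₀.not_reachable_deleteEdges hxy (reachable_of_sup ((deleteEdges_le _).trans h₀.le)
    ((deleteEdges_le _).trans h₁) (h₀.le hxy).2.1 hr)

theorem adj_of_reachable_sup (h₀ : IsInducedForest (within G S) F₀)
    (h₁ : F₁ ≤ within G Sᶜ) (hx : x ∈ S) (hxy : G.Adj x y) (hr : (F₀ ⊔ F₁).Reachable x y) :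
    F₀.Adj x y :=
  h₀.adj ⟨hxy, hx, mem_of_reachable_sup h₀.le h₁ hx hr⟩ (reachable_of_sup h₀.le h₁ hx hr)

theorem IsInducedForest.sup (h₀ : IsInducedForest (within G S) F₀)
    (h₁ : IsInducedForest (within G Sᶜ) F₁) : IsInducedForest G (F₀ ⊔ F₁) := by
  have hle : F₀ ≤ within G Sᶜᶜ := (compl_compl S).symm ▸ h₀.le
  refine ⟨isAcyclic_iff_forall_adj_isBridge.2 fun x y hxy => isBridge_iff.2 ?_,
    sup_le (h₀.le.trans within_le) (h₁.le.trans within_le), fun x y hxy hr => ?_⟩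
  · obtain hxy | hxy := hxy
    · exact not_reachable_sup_deleteEdges h₀ h₁.le hxy
    · rw [sup_comm]
      exact not_reachable_sup_deleteEdges h₁ hle hxy
  · by_cases hx : x ∈ S
    · exact Or.inl (adj_of_reachable_sup h₀ h₁.le hx hxy hr)
    · exact Or.inr (adj_of_reachable_sup h₁ hle hx hxy (sup_comm F₀ F₁ ▸ hr))

/-- The vertex `v` together with the component of `u` in `G - v`. -/
def branch (G : SimpleGraph V) (v u : V) : Set V :=
  insert v {x | (within G {v}ᶜ).Reachable u x}

theorem mem_branch_of_adj (hx : x ∈ branch G v u) (hxv : x ≠ v) (hxy : G.Adj x y) :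
    y ∈ branch G v u := by
  obtain hyv | hyv := eq_or_ne y v
  · exact Or.inl hyv
  · have hadj : (within G {v}ᶜ).Adj x y := ⟨hxy, hxv, hyv⟩
    exact Or.inr ((hx.resolve_left hxv).trans hadj.reachable)

theorem support_within_branch_ssubset {t : V} (hvt : G.Adj v t)
    (hut : ¬ (within G {v}ᶜ).Reachable u t) : (within G (branch G v u)).support ⊂ G.support := by
  refine ⟨support_mono within_le, fun hsub => ?_⟩
  obtain rfl | h := support_within_subset (hsub ⟨v, hvt.symm⟩)
  exacts [hvt.ne rfl, hut h]

theorem HasPendant.sup_of_within {r : V} (h₀ : F₀ ≤ within G S) (h₁ : F₁ ≤ within G Sᶜ)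
    (hS : ∀ x ∈ S, x ≠ v → ∀ y, G.Adj x y → y ∈ S) (hr : r ∉ S)
    (h : HasPendant (within G S) F₀ v) : HasPendant G (F₀ ⊔ F₁) r := by
  obtain ⟨x, y, hxv, hxy, huniq⟩ := h
  have hx : x ∈ S := support_within_subset (hxy.mem_support h₀)
  have hmono : F₀ ≤ F₀ ⊔ F₁ := le_sup_left
  have hreach {a b : V} : a ∈ S → (F₀ ⊔ F₁).Reachable a b → F₀.Reachable a b :=
    reachable_of_sup h₀ h₁
  obtain ⟨hnr, p, q, hp, hq, hpq⟩ := id hxy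
  refine ⟨x, y, fun h => hr (mem_of_reachable_sup h₀ h₁ hx h),
    ⟨fun h => hnr (hreach hx h), p, q, hp.mono hmono, hq.mono hmono, hpq.1⟩, ?_⟩
  rintro z ⟨hxz, p, q, hp, hq, hpq⟩
  have hpS := mem_of_reachable_sup h₀ h₁ hx hp
  have hqS : q ∈ S := hS p hpS (fun hpv => hxv (hpv ▸ hreach hx hp)) q hpq
  have hzq := (hreach hqS hq.symm).symm
  exact (huniq z ⟨fun h => hxz (h.mono hmono), p, q, hreach hx hp, hzq, hpq, hpS, hqS⟩).mono hmono

variable [Finite V]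

theorem IsOptimal.sup_within_compl (h : IsOptimal G ear F)
    (hS : ∀ x y, F.Adj x y → x ∈ S → y ∈ S) (h₁ : IsOptimal (within G S) ear F₁) :
    IsOptimal G ear (F₁ ⊔ within F Sᶜ) := by
  refine ⟨h₁.1.sup (h.1.within_within _), fun F' hF' => (h.2 F' hF').trans ?_⟩
  rw [← within_sup_within_compl hS,
    gain_sup (disjoint_of_le_within (within_mono h.1.le) (within_mono h.1.le)),
    within_sup_within_compl hS, gain_sup (disjoint_of_le_within h₁.1.le (within_mono h.1.le))]
  exact add_le_add_left (h₁.2 _ (h.1.within_within S)) _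

theorem IsOptimal.of_within_compl_singleton (h : IsOptimal (within G {v}ᶜ) ear F)
    (hv : ∀ w, G.Adj v w → ear s(v, w) ≠ 0) : IsOptimal G ear F := by
  refine ⟨h.1.of_within, fun F' hF' => le_trans ?_ (h.2 _ (hF'.within_within _))⟩
  rw [gain_eq_within_add v, add_le_iff_nonpos_right]
  refine finsum_mem_induction (· ≤ 0) le_rfl (fun _ _ => add_nonpos) fun w hw => ?_
  have := hv w (hF'.le hw)
  lia

end Separation

section PendantOptimum

open SimpleGraph

variable {V : Type*} [Finite V] {G F : SimpleGraph V} {ear : Sym2 V → ℕ} {u v t r : V}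

/-- Some optimal induced forest of `G` has an eared edge or a pendant component avoiding `r`. In the
first case any of the ears at that edge is a pendant single tree of the graph with its ears. -/
def HasPendantOptimum (G : SimpleGraph V) (ear : Sym2 V → ℕ) (r : V) : Prop :=
  ∃ F, IsOptimal G ear F ∧ (HasEaredEdge ear F ∨ HasPendant G F r)

namespace HasNeighbors

theorem exists_contract (h : HasNeighbors G v u t) (hvt : ear s(v, t) = 0)
    (hF : IsInducedForest G F) : ∃ F', IsInducedForest (contract G v t) F' ∧
      gain ear F ≤ gain (contractEar G ear v u t) F' + 1 := by
  by_cases hut : G.Adj u t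
  · exact h.exists_contract_of_adj hF hut
  · exact h.exists_contract_of_not_adj hvt hF hut

theorem isOptimal_of_contract {F' : SimpleGraph V} (h : HasNeighbors G v u t)
    (hvt : ear s(v, t) = 0)
    (hF' : IsOptimal (contract G v t) (contractEar G ear v u t) F') (hF : IsInducedForest G F)
    (hgain : gain ear F = gain (contractEar G ear v u t) F' + 1) : IsOptimal G ear F := by
  refine ⟨hF, fun F₀ hF₀ => ?_⟩
  obtain ⟨F₀', hF₀', hle⟩ := h.exists_contract hvt hF₀
  rw [hgain]
  exact hle.trans (add_le_add_left (hF'.2 F₀' hF₀') 1)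

theorem hasPendantOptimum_of_contract (h : HasNeighbors G v u t) (hvt : ear s(v, t) = 0)
    (hr : r ≠ v) (hG : HasPendantOptimum (contract G v t) (contractEar G ear v u t) r) :
    HasPendantOptimum G ear r := by
  obtain ⟨F', hF', hpend⟩ := hG
  by_cases hut : F'.Adj u t ∧ G.Adj u t
  · refine ⟨F', h.isOptimal_of_contract hvt hF' (h.isInducedForest_of_contract hF'.1 fun _ => hut.2)
      (gain_contractEar_of_adj hut.1 hut.2).symm, Or.inr ?_⟩
    exact h.hasPendant_of_notMem_support
      (fun hv => h.notMem_support_contract (support_mono hF'.1.le hv)) hut.1.reachable hr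
  · obtain ⟨F, hF, hreach, hgain, hear⟩ := h.exists_isInducedForest_of_contract hvt hF'.1 hut
    exact ⟨F, h.isOptimal_of_contract hvt hF' hF hgain,
      hpend.imp hear (h.hasPendant_of_contract hF'.1.le hreach hr)⟩

theorem isOptimal_sup_edge (h : HasNeighbors G v u t) (hear : ear s(v, u) = 1)
    (hF : IsOptimal G ear F) (hv : v ∉ F.support) (hut : ¬ F.Reachable u t) :
    IsOptimal G ear (F ⊔ edge v u) := by
  refine ⟨hF.1.sup_edge hv h.left fun y hvy hr => ?_, fun F' hF' => (hF.2 F' hF').trans ?_⟩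
  · refine (h.eq_or_eq y hvy).resolve_right ?_
    rintro rfl
    exact hut hr
  · rw [gain_sup_edge h.left.ne fun hvu => hv ⟨u, hvu⟩, hear]
    simp

end HasNeighbors

theorem hasPendantOptimum_of_within_branch (hle : F ≤ within G {v}ᶜ) (hF : IsOptimal G ear F)
    (hr : r ∉ branch G v u) (h : HasPendantOptimum (within G (branch G v u)) ear v) :
    HasPendantOptimum G ear r := by
  obtain ⟨F₁, hF₁, hpend⟩ := h
  have hadj : ∀ x y, F.Adj x y → x ∈ branch G v u → y ∈ branch G v u := fun x y hxy hx =>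
    mem_branch_of_adj hx (hle hxy).2.1 (hF.1.le hxy)
  refine ⟨_, hF.sup_within_compl hadj hF₁, hpend.imp ?_ ?_⟩
  · rintro ⟨e, he, hear⟩
    exact ⟨e, edgeSet_mono le_sup_left he, hear⟩
  · exact HasPendant.sup_of_within hF₁.1.le (within_mono hF.1.le)
      (fun x hx hxv y hxy => mem_branch_of_adj hx hxv hxy) hr

theorem HasNeighbors.hasPendantOptimum_of_pos (h : HasNeighbors G v u t) (hr : r ≠ v)
    (hu : ear s(v, u) ≠ 0) (ht : ear s(v, t) ≠ 0) (hK : ¬ HasEaredK23 G ear)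
    (hbranch : ∀ w, G.Adj v w → (within G (branch G v w)).support ⊂ G.support →
      HasPendantOptimum (within G (branch G v w)) ear v) : HasPendantOptimum G ear r := by
  obtain ⟨F, hF₀⟩ := exists_isOptimal (within G {v}ᶜ) ear
  have hF : IsOptimal G ear F := hF₀.of_within_compl_singleton fun w hw => by
    obtain rfl | rfl := h.eq_or_eq w hw <;> assumption
  have hv : v ∉ F.support := fun hv => support_within_subset (support_mono hF₀.1.le hv) rfl
  by_cases hut : F.Reachable u t
  · exact ⟨F, hF, Or.inr (h.hasPendant_of_notMem_support hv hut hr)⟩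
  by_cases hu₁ : ear s(v, u) = 1
  · exact ⟨_, h.isOptimal_sup_edge hu₁ hF hv hut,
      Or.inl ⟨s(v, u), Or.inr ((edge_adj ..).2 ⟨Or.inl ⟨rfl, rfl⟩, h.left.ne⟩), hu⟩⟩
  have hcut := h.not_reachable_within_of_two_le (fun hut' => hut (hut' ▸ .refl u)) (by lia) hK
  obtain ⟨w, w', hw, hw', hww', hwr⟩ : ∃ w w', G.Adj v w ∧ G.Adj v w' ∧
      ¬ (within G {v}ᶜ).Reachable w w' ∧ ¬ (within G {v}ᶜ).Reachable w r := by
    by_cases hur : (within G {v}ᶜ).Reachable u r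
    · exact ⟨t, u, h.right, h.left, fun htu => hcut htu.symm, fun htr => hcut (hur.trans htr.symm)⟩
    · exact ⟨u, t, h.left, h.right, hcut, hur⟩
  exact hasPendantOptimum_of_within_branch hF₀.1.le hF (not_or.2 ⟨hr, hwr⟩)
    (hbranch w hw (support_within_branch_ssubset hw' hww'))

theorem hasPendantOptimum (hK₄ : ¬ IsMinor (⊤ : SimpleGraph (Fin 4)) G)
    (hK₂₃ : ¬ HasEaredK23 G ear) (hG : HasEaredCycle G ear) (r : V) :
    HasPendantOptimum G ear r := by
  induction hn : G.support.ncard using Nat.strong_induction_on generalizing G ear r with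
  | _ n ih =>
    subst hn
    obtain ⟨v, hvr, u, t, h⟩ := exists_hasNeighbors hK₄ hG.ne_bot r
    have hdeg : ∀ i : Fin 4, ∃ j, (⊤ : SimpleGraph (Fin 4)).Adj i j := fun i =>
      (exists_ne i).imp fun _ => Ne.symm
    have hcontract {u t : V} (h : HasNeighbors G v u t) (hvt : ear s(v, t) = 0) :
        HasPendantOptimum G ear r :=
      h.hasPendantOptimum_of_contract hvt hvr.symm <|
        ih _ (Set.ncard_lt_ncard h.support_contract_ssubset)
          (mt (h.isMinor_of_contract hdeg) hK₄) (mt h.hasEaredK23_of_contract hK₂₃)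
          (h.hasEaredCycle_contract hvt hG) r rfl
    by_cases ht : ear s(v, t) = 0
    · exact hcontract h ht
    by_cases hu : ear s(v, u) = 0
    · exact hcontract h.symm hu
    refine h.hasPendantOptimum_of_pos hvr.symm hu ht hK₂₃ fun w hvw hlt => ?_
    refine ih _ (Set.ncard_lt_ncard hlt) (mt (·.mono within_le) hK₄)
      (mt (·.mono within_le) hK₂₃) (Or.inr ⟨s(v, w), ?_, ?_⟩) v rfl
    · exact ⟨hvw, Or.inl rfl, Or.inr (.refl w)⟩
    · obtain rfl | rfl := h.eq_or_eq w hvw <;> assumption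

end PendantOptimum

section TreeCovering

open SimpleGraph

variable {V : Type*} {G F : SimpleGraph V} {x y : V} {S T : Set V} {𝒮 : Set (Set V)}

/-- The family of vertex sets of the trees of the forest `F`. -/
def treesOf (F : SimpleGraph V) : Set (Set V) :=
  Set.range fun c : F.ConnectedComponent => c.supp

theorem supp_connectedComponentMk : (F.connectedComponentMk x).supp = {y | F.Reachable x y} :=
  Set.ext fun _ => ConnectedComponent.eq.trans reachable_comm

theorem mem_treesOf_iff : T ∈ treesOf F ↔ ∃ x, {y | F.Reachable x y} = T := by
  simp_rw [← supp_connectedComponentMk]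
  exact ⟨fun ⟨c, hc⟩ => c.ind (fun x hx => ⟨x, hx⟩) hc, fun ⟨x, hx⟩ => ⟨_, hx⟩⟩

theorem encard_treesOf [Finite V] : (treesOf F).encard = Nat.card F.ConnectedComponent := by
  rw [treesOf, ← Set.image_univ, ConnectedComponent.supp_injective.encard_image, Set.encard_univ,
    ENat.card_eq_coe_natCard]

theorem setOf_reachable_eq_iff :
    {z | F.Reachable x z} = {z | F.Reachable y z} ↔ F.Reachable x y := by
  simp_rw [← supp_connectedComponentMk, ConnectedComponent.supp_inj, ConnectedComponent.eq]

theorem IsInducedForest.isTreeCovering_treesOf (h : IsInducedForest G F) :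
    G.IsTreeCovering (treesOf F) := by
  refine ⟨?_, ?_, fun v => ⟨_, mem_treesOf_iff.2 ⟨v, rfl⟩, .refl v⟩⟩
  · rintro _ ⟨c, rfl⟩
    have hc : G.induce c.supp = F.induce c.supp := by
      ext x y
      exact ⟨fun hxy => h.adj hxy (c.reachable_of_mem_supp x.2 y.2), fun hxy => h.le hxy⟩
    exact hc ▸ h.isAcyclic.isTree_connectedComponent c
  · rintro _ ⟨c, rfl⟩ _ ⟨d, rfl⟩ hcd
    exact pairwise_disjoint_supp_connectedComponent F fun h => hcd (congrArg _ h)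

/-- The union of the trees of the tree covering `𝒮`. -/
def forestOf (G : SimpleGraph V) (𝒮 : Set (Set V)) : SimpleGraph V where
  Adj x y := G.Adj x y ∧ ∃ S ∈ 𝒮, x ∈ S ∧ y ∈ S
  symm := ⟨fun _ _ ⟨h, S, hS, hx, hy⟩ => ⟨h.symm, S, hS, hy, hx⟩⟩
  loopless := ⟨fun _ h => h.1.ne rfl⟩

theorem eq_of_mem_of_isTreeCovering (h : G.IsTreeCovering 𝒮) (hS : S ∈ 𝒮) (hT : T ∈ 𝒮)
    (hxS : x ∈ S) (hxT : x ∈ T) : S = T := by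
  by_contra hne
  exact Set.disjoint_left.1 (h.disjoint S hS T hT hne) hxS hxT

theorem forestOf_adj_iff (h : G.IsTreeCovering 𝒮) (hS : S ∈ 𝒮) (hx : x ∈ S) :
    (forestOf G 𝒮).Adj x y ↔ G.Adj x y ∧ y ∈ S := by
  refine and_congr_right fun _ => ⟨?_, fun hy => ⟨S, hS, hx, hy⟩⟩
  rintro ⟨T, hT, hxT, hyT⟩
  rwa [eq_of_mem_of_isTreeCovering h hS hT hx hxT]

theorem reachable_forestOf_iff (h : G.IsTreeCovering 𝒮) (hS : S ∈ 𝒮) (hx : x ∈ S) :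
    (forestOf G 𝒮).Reachable x y ↔ y ∈ S := by
  refine ⟨fun hr => ?_, fun hy => ?_⟩
  · obtain ⟨p⟩ := hr
    induction p with
    | nil => exact hx
    | cons hab _ ih => exact ih ((forestOf_adj_iff h hS hx).1 hab).2
  · refine reachable_of_forall_adj (F := G.induce S) (m := Subtype.val)
      (fun a b hab => Adj.reachable ?_) ((h.isTree S hS).connected.preconnected ⟨x, hx⟩ ⟨y, hy⟩)
    exact ⟨hab, S, hS, a.2, b.2⟩

theorem treesOf_forestOf (h : G.IsTreeCovering 𝒮) : treesOf (forestOf G 𝒮) = 𝒮 := by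
  ext T
  rw [mem_treesOf_iff]
  constructor
  · rintro ⟨x, rfl⟩
    obtain ⟨S, hS, hx⟩ := h.cover x
    exact (Set.ext fun _ => reachable_forestOf_iff h hS hx : {y | _} = S) ▸ hS
  · intro hT
    obtain ⟨⟨x, hx⟩⟩ := (h.isTree T hT).connected.nonempty
    exact ⟨x, Set.ext fun _ => reachable_forestOf_iff h hT hx⟩

theorem isInducedForest_forestOf (h : G.IsTreeCovering 𝒮) : IsInducedForest G (forestOf G 𝒮) := by
  refine ⟨?_, fun _ _ hxy => hxy.1, fun x y hxy hr => ?_⟩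
  · intro x c hc
    obtain ⟨S, hS, hx⟩ := h.cover x
    have hcS : ∀ y ∈ c.support, y ∈ S := fun y hy => by
      classical exact (reachable_forestOf_iff h hS hx).1 (c.takeUntil y hy).reachable
    have hle : (forestOf G 𝒮).induce S ≤ G.induce S := fun _ _ hab => hab.1
    refine ((h.isTree S hS).isAcyclic.anti hle) (c.induce S hcS) ?_
    rwa [← Walk.isCycle_map_iff_of_injective (f := (Embedding.induce S).toHom)
      Subtype.val_injective, Walk.map_induce]
  · obtain ⟨S, hS, hx⟩ := h.cover x
    exact (forestOf_adj_iff h hS hx).2 ⟨hxy, (reachable_forestOf_iff h hS hx).1 hr⟩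

theorem HasPendant.exists_isPendantTree {r : V} (h : HasPendant G F r) :
    ∃ T, G.IsPendantTree (treesOf F) T := by
  obtain ⟨x, y, -, ⟨hxy, p, q, hp, hq, hpq⟩, huniq⟩ := h
  refine ⟨{z | F.Reachable x z}, mem_treesOf_iff.2 ⟨x, rfl⟩, {z | F.Reachable y z},
    ⟨mem_treesOf_iff.2 ⟨y, rfl⟩, fun h => hxy (setOf_reachable_eq_iff.1 h).symm, p, hp, q, hq, hpq⟩,
    ?_⟩
  rintro S ⟨hS, hne, p, hp, q, hq, hpq⟩
  obtain ⟨z, rfl⟩ := mem_treesOf_iff.1 hS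
  exact setOf_reachable_eq_iff.2
    (huniq z ⟨fun h => hne (setOf_reachable_eq_iff.2 h.symm), p, q, hp, hq, hpq⟩).symm

theorem sum_degree_supp_add_two [Fintype V] [DecidableRel F.Adj]
    [DecidableEq F.ConnectedComponent] (hF : F.IsAcyclic) (c : F.ConnectedComponent) :
    ∑ x with F.connectedComponentMk x = c, F.degree x + 2 =
      2 * Finset.card {x | F.connectedComponentMk x = c} := by
  classical
  have hsupp (x : V) :
      x ∈ Finset.univ.filter (F.connectedComponentMk · = c) ↔ x ∈ c.supp := by simp
  have hdeg (x : c.supp) : (F.induce c.supp).degree x = F.degree x :=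
    degree_induce_of_neighborSet_subset fun y hy => c.mem_supp_of_adj_mem_supp x.2 hy
  have htree : (F.induce c.supp).IsTree := hF.isTree_connectedComponent c
  calc ∑ x with F.connectedComponentMk x = c, F.degree x + 2
      = ∑ x : c.supp, (F.induce c.supp).degree x + 2 := by
        simp only [hdeg, Finset.sum_subtype _ hsupp]
    _ = 2 * Fintype.card c.supp := by
        rw [sum_degrees_eq_twice_card_edges, ← htree.card_edgeFinset, mul_add, mul_one]
    _ = _ := by rw [← Fintype.card_of_subtype _ hsupp]

theorem card_connectedComponent_add_ncard_edgeSet [Finite V] (hF : F.IsAcyclic) :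
    Nat.card F.ConnectedComponent + F.edgeSet.ncard = Nat.card V := by
  classical
  have := Fintype.ofFinite V
  have hdegree := Finset.sum_fiberwise .univ F.connectedComponentMk (F.degree ·)
  have hcard := Finset.sum_fiberwise .univ F.connectedComponentMk fun _ => 1
  have hsum := Fintype.sum_congr _ _ (sum_degree_supp_add_two hF)
  simp only [← Finset.card_eq_sum_ones] at hcard
  rw [Finset.sum_add_distrib, hdegree, sum_degrees_eq_twice_card_edges, Finset.sum_const,
    smul_eq_mul, Finset.card_univ, ← Finset.mul_sum, hcard, Finset.card_univ] at hsum
  rw [← coe_edgeFinset, Set.ncard_coe_finset, Nat.card_eq_fintype_card, Nat.card_eq_fintype_card]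
  lia

theorem gain_zero [Finite V] : gain 0 F = F.edgeSet.ncard := by
  simp [gain, finsum_mem_eq_finite_toFinset_sum _ F.edgeSet.toFinite,
    Set.ncard_eq_toFinset_card F.edgeSet F.edgeSet.toFinite]

theorem IsOptimal.isMinimumTreeCovering_treesOf [Finite V] (h : IsOptimal G 0 F) :
    G.IsMinimumTreeCovering (treesOf F) := by
  refine ⟨h.1.isTreeCovering_treesOf, fun 𝒮 h𝒮 => ?_⟩
  have hforest := isInducedForest_forestOf h𝒮
  have hgain := h.2 _ hforest
  rw [gain_zero, gain_zero] at hgain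
  have hF := card_connectedComponent_add_ncard_edgeSet h.1.isAcyclic
  have h𝒮F := card_connectedComponent_add_ncard_edgeSet hforest.isAcyclic
  rw [← treesOf_forestOf h𝒮, encard_treesOf, encard_treesOf, Nat.cast_le]
  lia

end TreeCovering

section Outerplanar

open SimpleGraph

variable {V : Type*} [Finite V] {G : SimpleGraph V}

theorem not_isMinor_K4_of_isOuterplanar (hG : G.IsOuterplanar) :
    ¬ IsMinor (⊤ : SimpleGraph (Fin 4)) G :=
  fun ⟨_, hB⟩ => hB.not_isOuterplanar_of_K4 hG

theorem not_hasEaredK23_zero_of_isOuterplanar (hG : G.IsOuterplanar) : ¬ HasEaredK23 G 0 := by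
  rintro ⟨n, B, hB, hn⟩
  have hn : 3 ≤ n + 1 := by
    obtain hn | ⟨_, _, _, _, _, hn⟩ := hn
    exacts [by lia, by simpa using hn]
  exact (hB.comp (f := Sum.map id (Fin.castLE hn)) (Function.injective_id.sumMap
    (Fin.castLE_injective hn)) (by simp)).not_isOuterplanar_of_K23 hG

end Outerplanar

theorem theorem8p2 {V : Type*} [Finite V] (G : SimpleGraph V) (hG : G.IsOuterplanar)
    (hcyc : ¬ G.IsAcyclic) :
    ∃ 𝒯 : Set (Set V), G.IsMinimumTreeCovering 𝒯 ∧ ∃ T : Set V, G.IsPendantTree 𝒯 T := by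
  have : Nonempty V := by
    by_contra hV
    rw [not_nonempty_iff] at hV
    exact hcyc .of_subsingleton
  obtain ⟨F, hF, ⟨e, -, he⟩ | hpend⟩ := hasPendantOptimum (not_isMinor_K4_of_isOuterplanar hG)
    (not_hasEaredK23_zero_of_isOuterplanar hG) (Or.inl hcyc) (Classical.arbitrary V)
  · exact (he rfl).elim
  · exact ⟨treesOf F, hF.isMinimumTreeCovering_treesOf, hpend.exists_isPendantTree⟩
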